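/- Let $p$ be a prime number. For a ring $R$ put $R_1=R/pR$, and for an $R_1$-module $M$ let $F^*M=R_1\otimes_{F,R_1}M$ be its scalar extension by the absolute Frobenius $F\colon R_1\to R_1$, $x\mapsto x^p$. Let $P=\sum_{i=1}^{p-1}\frac{(p-1)!}{i!(p-i)!}X^iY^{p-i}\in\mathbf Z[X,Y]$. A Frobenius--Witt derivation of a ring $R$ with values in an $R$-module $M$ is a map $w\colon R\to M$ such that, for all $a,b\in R$, $$w(a+b)=w(a)+w(b)-P(a,b)\,w(p),\qquad w(ab)=b^p\,w(a)+a^p\,w(b).$$ Let $w\colon R\to F\Omega^1_R$ be the universal Frobenius--Witt derivation of $R$. If $R$ is a $\mathbf Z_{(p)}$-algebra, then $p\cdot F\Omega^1_R=0$, so $F\Omega^1_R$ is an $R_1$-module. Let $f\colon A\to B$ be a morphism of finite presentation of rings over $\mathbf Z_{(p)}$. Consider the sequence of $B_1$-modules $$0\to F\Omega^1_A\otimes_A B\to F\Omega^1_B\to F^*\Omega^1_{B_1/A_1}\to 0,\qquad(*)$$ where the first map sends $w(a)\otimes b$ to $b\cdot w(f(a))$ and the second sends $w(b)$ to $1\otimes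 d\bar b$ with $\bar b$ the class of $b$ in $B_1$. 1. If $f$ is smooth, then $(*)$ is a split exact sequence, and the map $$\mathrm{Coker}(F\Omega^1_A\otimes_A B\to F\Omega^1_B)\to F^*\Omega^1_{B_1/A_1}$$ induced by the second map is an isomorphism of projective $B_1$-modules of finite rank (that is, finitely generated projective $B_1$-modules). 2. Let $\mathfrak q$ be a prime ideal of $B$ whose residue field is of characteristic $p$, and let $\mathfrak p\subset A$ be its inverse image. Assume that $A_{\mathfrak p}$ and $B_{\mathfrak q}$ are regular local rings and that $(*)$ becomes a split exact sequence after $\otimes_B B_{\mathfrak q}$. Then $f$ is smooth at $\mathfrak q$, i.e. there is $g\in B\setminus\mathfrak q$ such that $B[1/g]$ is smooth over $A$. -/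

import Mathlib

open scoped TensorProduct

noncomputable section

/-! ### Frobenius-Witt derivations -/

/-- The value at `(a, b)` of the integral polynomial
`P = ∑_{i=1}^{p-1} (p-1)! / (i! (p-i)!) X^i Y^{p-i}`
(the natural number divisions are exact, see `FW.coeff_mul`). -/
def FW.P (p : ℕ) {A : Type*} [CommRing A] (a b : A) : A :=
  ∑ i ∈ Finset.Icc 1 (p - 1),
    (((p - 1).factorial / (i.factorial * (p - i).factorial) : ℕ) : A) * a ^ i * b ^ (p - i)

/-- For `0 < i < p` the quotient `(p-1)! / (i! (p-i)!)` is exact. -/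
theorem FW.coeff_mul (p : ℕ) [hp : Fact p.Prime] {i : ℕ} (hi : i ∈ Finset.Icc 1 (p - 1)) :
    (p - 1).factorial / (i.factorial * (p - i).factorial) * (i.factorial * (p - i).factorial)
      = (p - 1).factorial := by
  have h1 := hp.out.one_lt
  obtain ⟨h2, h3⟩ := Finset.mem_Icc.mp hi
  apply Nat.div_mul_cancel
  obtain ⟨c, hc⟩ := hp.out.dvd_choose_self (k := i) (by omega) (by omega)
  have h4 := Nat.choose_mul_factorial_mul_factorial (n := p) (k := i) (by omega)
  have h5 := Nat.mul_factorial_pred (n := p) (by omega)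
  refine ⟨c, Nat.eq_of_mul_eq_mul_left hp.out.pos ?_⟩
  rw [h5, ← h4, hc]
  ring

/-- `P = ((X + Y)^p - X^p - Y^p) / p`. -/
theorem FW.mul_P (p : ℕ) [hp : Fact p.Prime] {A : Type*} [CommRing A] (a b : A) :
    (p : A) * FW.P p a b = (a + b) ^ p - a ^ p - b ^ p := by
  have h1 := hp.out.one_lt
  obtain ⟨m, rfl⟩ : ∃ m, p = m + 1 := ⟨p - 1, by omega⟩
  rw [add_pow, Finset.sum_range_succ, Finset.sum_range_eq_add_Ico _ (by omega)]
  have h2 : Finset.Icc 1 (m + 1 - 1) = Finset.Ico 1 (m + 1) := by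
    ext i; simp only [Finset.mem_Icc, Finset.mem_Ico]; omega
  have h3 : ((m + 1 : ℕ) : A) * FW.P (m + 1) a b
      = ∑ i ∈ Finset.Ico 1 (m + 1), a ^ i * b ^ (m + 1 - i) * ((m + 1).choose i : A) := by
    rw [FW.P, Finset.mul_sum, h2]
    refine Finset.sum_congr rfl fun i hi => ?_
    rw [← h2] at hi
    have h4 := FW.coeff_mul (m + 1) hi
    obtain ⟨h5, h6⟩ := Finset.mem_Icc.mp hi
    have h7 : (m + 1) * ((m + 1 - 1).factorial / (i.factorial * (m + 1 - i).factorial))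
        = (m + 1).choose i := by
      have h8 := Nat.choose_mul_factorial_mul_factorial (n := m + 1) (k := i) (by omega)
      have h9 := Nat.mul_factorial_pred (n := m + 1) (by omega)
      refine Nat.eq_of_mul_eq_mul_right
        (Nat.mul_pos i.factorial_pos (m + 1 - i).factorial_pos) ?_
      rw [mul_assoc, h4, h9, ← mul_assoc, h8]
    rw [← h7]
    push_cast
    ring
  rw [h3]
  simp

theorem FW.P_mul_mul (p : ℕ) {A : Type*} [CommRing A] (c a b : A) :
    FW.P p (a * c) (b * c) = c ^ p * FW.P p a b := by
  rw [FW.P, FW.P, Finset.mul_sum]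
  refine Finset.sum_congr rfl fun i hi => ?_
  obtain ⟨h5, h6⟩ := Finset.mem_Icc.mp hi
  have : c ^ p = c ^ i * c ^ (p - i) := by rw [← pow_add]; congr 1; omega
  rw [this]
  ring

theorem FW.P_map (p : ℕ) {A B : Type*} [CommRing A] [CommRing B] (f : A →+* B) (a b : A) :
    f (FW.P p a b) = FW.P p (f a) (f b) := by
  simp [FW.P]

/-- Frobenius-Witt derivations of a ring `A` with values in an `A`-module `M`. -/
structure IsFWDerivation (p : ℕ) {A M : Type*} [CommRing A] [AddCommGroup M] [Module A M]
    (w : A → M) : Prop where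
  map_add : ∀ a b : A, w (a + b) = w a + w b - FW.P p a b • w (p : A)
  map_mul : ∀ a b : A, w (a * b) = b ^ p • w a + a ^ p • w b

/-! ### The universal Frobenius-Witt derivation -/

/-- The submodule of relations of the module of Frobenius-Witt differentials. -/
def FW.relations (p : ℕ) (A : Type*) [CommRing A] : Submodule A (A →₀ A) :=
  Submodule.span A
    ({x | ∃ a b : A, x = Finsupp.single (a + b) 1 - Finsupp.single a 1 - Finsupp.single b 1
        + FW.P p a b • Finsupp.single (p : A) 1} ∪
     {x | ∃ a b : A, x = Finsupp.single (a * b) 1 - a ^ p • Finsupp.single b 1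
        - b ^ p • Finsupp.single a 1})

/-- The module `FΩ¹_A` of Frobenius-Witt differentials: the quotient of the free module `A^(A)`
by the relations `[a+b] - [a] - [b] + P(a,b)[p]` and `[ab] - a^p[b] - b^p[a]`. -/
def FWDiff (p : ℕ) (A : Type*) [CommRing A] : Type _ :=
  (A →₀ A) ⧸ FW.relations p A

namespace FWDiff

variable (p : ℕ) (A : Type*) [CommRing A]

instance : AddCommGroup (FWDiff p A) :=
  inferInstanceAs (AddCommGroup ((A →₀ A) ⧸ FW.relations p A))

/-- `FΩ¹_A` is a module over `A`, and over every ring over which `A` is an algebra. -/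
instance {S : Type*} [CommRing S] [Algebra S A] : Module S (FWDiff p A) :=
  inferInstanceAs (Module S ((A →₀ A) ⧸ FW.relations p A))

instance {S : Type*} [CommRing S] [Algebra S A] : IsScalarTower S A (FWDiff p A) :=
  inferInstanceAs (IsScalarTower S A ((A →₀ A) ⧸ FW.relations p A))

/-- The canonical surjection `A^(A) → FΩ¹_A`. -/
def mk : (A →₀ A) →ₗ[A] FWDiff p A :=
  (FW.relations p A).mkQ

theorem mk_surjective : Function.Surjective (mk p A) :=
  (FW.relations p A).mkQ_surjective

theorem mk_eq_zero {x : A →₀ A} (hx : x ∈ FW.relations p A) : mk p A x = 0 :=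
  (Submodule.Quotient.mk_eq_zero _).mpr hx

/-- The universal Frobenius-Witt derivation `w : A → FΩ¹_A`. -/
def w (a : A) : FWDiff p A :=
  mk p A (Finsupp.single a 1)

theorem isFWDerivation_w : IsFWDerivation p (w p A) where
  map_add a b := by
    have h := mk_eq_zero p A (Submodule.subset_span (Or.inl ⟨a, b, rfl⟩))
    rw [_root_.map_add, _root_.map_sub, _root_.map_sub, map_smul] at h
    rw [← sub_eq_zero, ← h]
    unfold w
    abel
  map_mul a b := by
    have h := mk_eq_zero p A (Submodule.subset_span (Or.inr ⟨a, b, rfl⟩))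
    rw [_root_.map_sub, _root_.map_sub, map_smul, map_smul] at h
    rw [← sub_eq_zero, ← h]
    unfold w
    abel

variable {A}

theorem span_range_w : Submodule.span A (Set.range (w p A)) = ⊤ := by
  rw [eq_top_iff]
  rintro x -
  obtain ⟨y, rfl⟩ := mk_surjective p A x
  induction y using Finsupp.induction_linear with
  | zero => simp
  | add f g hf hg => rw [_root_.map_add]; exact add_mem hf hg
  | single a c =>
    have h : Finsupp.single a c = c • Finsupp.single a (1 : A) := by simp
    rw [h, map_smul]
    exact Submodule.smul_mem _ _ (Submodule.subset_span ⟨a, rfl⟩)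

variable {p} {M : Type*} [AddCommGroup M] [Module A M]

/-- The linear map `FΩ¹_A → M` induced by a Frobenius-Witt derivation `A → M`. -/
def lift (D : A → M) (hD : IsFWDerivation p D) : FWDiff p A →ₗ[A] M :=
  (FW.relations p A).liftQ (Finsupp.linearCombination A D) <| by
    rw [FW.relations, Submodule.span_le]
    rintro _ (⟨a, b, rfl⟩ | ⟨a, b, rfl⟩)
    · simp [hD.map_add]
      abel
    · simp [hD.map_mul]

@[simp] theorem lift_w (D : A → M) (hD : IsFWDerivation p D) (a : A) :
    lift D hD (w p A a) = D a :=
  (Submodule.liftQ_apply _ _ _).trans (by simp)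

theorem hom_ext {f g : FWDiff p A →ₗ[A] M} (h : ∀ a, f (w p A a) = g (w p A a)) : f = g :=
  LinearMap.ext_on_range (span_range_w p) h

/-- `w : A → FΩ¹_A` is a universal Frobenius-Witt derivation. -/
theorem existsUnique_lift (D : A → M) (hD : IsFWDerivation p D) :
    ∃! f : FWDiff p A →ₗ[A] M, ∀ a, f (w p A a) = D a :=
  ⟨lift D hD, lift_w D hD, fun _ hf => hom_ext fun a => (hf a).trans (lift_w D hD a).symm⟩

end FWDiff

/-- A Frobenius-Witt derivation of `B` restricts to one of `A` along `A → B`. -/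
theorem IsFWDerivation.comp_algebraMap {p : ℕ} {A B M : Type*} [CommRing A] [CommRing B]
    [Algebra A B] [AddCommGroup M] [Module A M] [Module B M] [IsScalarTower A B M]
    {D : B → M} (hD : IsFWDerivation p D) :
    IsFWDerivation p (fun a : A => D (algebraMap A B a)) where
  map_add a b := by
    simp only [_root_.map_add, hD.map_add, map_natCast, ← FW.P_map, algebraMap_smul]
  map_mul a b := by
    simp only [_root_.map_mul, hD.map_mul, ← map_pow, algebraMap_smul]

namespace FWDiff

variable (p : ℕ) (A B : Type*) [CommRing A] [CommRing B] [Algebra A B]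

/-- The canonical `A`-linear map `FΩ¹_A → FΩ¹_B`, `w(a) ↦ w(a)`. -/
def map : FWDiff p A →ₗ[A] FWDiff p B :=
  lift (fun a : A => w p B (algebraMap A B a)) (isFWDerivation_w p B).comp_algebraMap

/-- The canonical `B`-linear map `FΩ¹_A ⊗_A B → FΩ¹_B`. -/
def mapBaseChange : B ⊗[A] FWDiff p A →ₗ[B] FWDiff p B :=
  (map p A B).liftBaseChange B

theorem mapBaseChange_tmul_w (b : B) (a : A) :
    mapBaseChange p A B (b ⊗ₜ w p A a) = b • w p B (algebraMap A B a) := by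
  simp [mapBaseChange, map]

end FWDiff

/-! ### Reduction modulo `p` and Frobenius pull-back -/

/-- The ring `A₁ = A/pA`. -/
abbrev RingModP (p : ℕ) (A : Type*) [CommRing A] : Type _ :=
  A ⧸ Ideal.span {(p : A)}

theorem RingModP.natCast_eq_zero (p : ℕ) (A : Type*) [CommRing A] : (p : RingModP p A) = 0 := by
  rw [← map_natCast (Ideal.Quotient.mk (Ideal.span {(p : A)})), Ideal.Quotient.eq_zero_iff_mem]
  exact Ideal.mem_span_singleton_self _

/-- The ring morphism `A/pA → B/pB` induced by `A → B`. -/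
def RingModP.map (p : ℕ) (A B : Type*) [CommRing A] [CommRing B] [Algebra A B] :
    RingModP p A →+* RingModP p B :=
  Ideal.quotientMap _ (algebraMap A B) <| by
    rw [Ideal.span_singleton_le_iff_mem, Ideal.mem_comap, map_natCast]
    exact Ideal.mem_span_singleton_self _

/-- `Ω¹_{B₁/A₁}` for `A₁ = A/pA` and `B₁ = B/pB`. -/
abbrev KaehlerModP (p : ℕ) (A B : Type*) [CommRing A] [CommRing B] [Algebra A B] : Type _ :=
  letI : Algebra (RingModP p A) (RingModP p B) := (RingModP.map p A B).toAlgebra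
  Ω[RingModP p B⁄RingModP p A]

/-- The differential `B₁ → Ω¹_{B₁/A₁}`. -/
def KaehlerModP.d (p : ℕ) (A B : Type*) [CommRing A] [CommRing B] [Algebra A B] :
    RingModP p B → KaehlerModP p A B :=
  letI : Algebra (RingModP p A) (RingModP p B) := (RingModP.map p A B).toAlgebra
  fun x => KaehlerDifferential.D (RingModP p A) (RingModP p B) x

theorem KaehlerModP.d_add (p : ℕ) (A B : Type*) [CommRing A] [CommRing B] [Algebra A B]
    (x y : RingModP p B) :
    KaehlerModP.d p A B (x + y) = KaehlerModP.d p A B x + KaehlerModP.d p A B y := by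
  let _ : Algebra (RingModP p A) (RingModP p B) := (RingModP.map p A B).toAlgebra
  exact (KaehlerDifferential.D (RingModP p A) (RingModP p B)).map_add x y

theorem KaehlerModP.d_mul (p : ℕ) (A B : Type*) [CommRing A] [CommRing B] [Algebra A B]
    (x y : RingModP p B) :
    KaehlerModP.d p A B (x * y) = x • KaehlerModP.d p A B y + y • KaehlerModP.d p A B x := by
  let _ : Algebra (RingModP p A) (RingModP p B) := (RingModP.map p A B).toAlgebra
  exact (KaehlerDifferential.D (RingModP p A) (RingModP p B)).leibniz x y

theorem KaehlerModP.d_map (p : ℕ) (A B : Type*) [CommRing A] [CommRing B] [Algebra A B]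
    (x : RingModP p A) : KaehlerModP.d p A B (RingModP.map p A B x) = 0 := by
  let _ : Algebra (RingModP p A) (RingModP p B) := (RingModP.map p A B).toAlgebra
  exact (KaehlerDifferential.D (RingModP p A) (RingModP p B)).map_algebraMap x

/-- The absolute Frobenius `F : B/pB → B/pB`, `x ↦ x ^ p` (also when `B/pB = 0`). -/
def RingModP.frob (p : ℕ) [hp : Fact p.Prime] (B : Type*) [CommRing B] : RingModP p B →+* RingModP p B where
  toFun x := x ^ p
  map_one' := one_pow p
  map_mul' x y := mul_pow x y p
  map_zero' := zero_pow hp.out.ne_zero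
  map_add' x y := by
    obtain ⟨r, hr⟩ := exists_add_pow_prime_eq hp.out x y
    rw [hr, RingModP.natCast_eq_zero]
    ring

/-- `B₁ = B/pB`, regarded as a `B₁`-algebra by the absolute Frobenius. -/
def FrobTwist (p : ℕ) (B : Type*) [CommRing B] : Type _ :=
  RingModP p B

instance (p : ℕ) (B : Type*) [CommRing B] : CommRing (FrobTwist p B) :=
  inferInstanceAs (CommRing (RingModP p B))

instance (p : ℕ) [Fact p.Prime] (B : Type*) [CommRing B] : Algebra (RingModP p B) (FrobTwist p B) :=
  (show RingModP p B →+* FrobTwist p B from RingModP.frob p B).toAlgebra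

/-- The scalar extension `F^*M = B₁ ⊗_{F, B₁} M` of a `B₁`-module `M` by the absolute Frobenius
`F` of `B₁ = B/pB`. -/
def FrobPullback (p : ℕ) [Fact p.Prime] (B : Type*) [CommRing B]
    (M : Type*) [AddCommGroup M] [Module (RingModP p B) M] : Type _ :=
  FrobTwist p B ⊗[RingModP p B] M

namespace FrobPullback

variable (p : ℕ) [Fact p.Prime] (B : Type*) [CommRing B]
  (M : Type*) [AddCommGroup M] [Module (RingModP p B) M]

instance : AddCommGroup (FrobPullback p B M) :=
  inferInstanceAs (AddCommGroup (FrobTwist p B ⊗[RingModP p B] M))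

/-- The `B₁`-module structure of `F^*M`, by multiplication on the factor `B₁`. -/
instance : Module (RingModP p B) (FrobPullback p B M) :=
  inferInstanceAs (Module (FrobTwist p B) (FrobTwist p B ⊗[RingModP p B] M))

/-- `F^*M` as a `B`-module, through `B → B₁`. -/
instance : Module B (FrobPullback p B M) :=
  Module.compHom _ (Ideal.Quotient.mk (Ideal.span {(p : B)}))

instance : IsScalarTower B (RingModP p B) (FrobPullback p B M) where
  smul_assoc b x m := by
    change ((Ideal.Quotient.mk (Ideal.span {(p : B)}) b : RingModP p B) * x) • m
      = (Ideal.Quotient.mk (Ideal.span {(p : B)}) b : RingModP p B) • x • m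
    exact mul_smul _ _ _

variable {M}

/-- The canonical map `M → F^*M`, `m ↦ 1 ⊗ m`. -/
def of (m : M) : FrobPullback p B M :=
  (1 : FrobTwist p B) ⊗ₜ[RingModP p B] m

theorem of_add (m n : M) : of p B (m + n) = of p B m + of p B n :=
  TensorProduct.tmul_add _ _ _

theorem of_zero : of p B (0 : M) = 0 :=
  TensorProduct.tmul_zero _ _

theorem of_smul (x : RingModP p B) (m : M) : of p B (x • m) = x ^ p • of p B m := by
  change (1 : FrobTwist p B) ⊗ₜ[RingModP p B] (x • m)
    = (show FrobTwist p B from x ^ p) • ((1 : FrobTwist p B) ⊗ₜ[RingModP p B] m)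
  rw [← TensorProduct.smul_tmul, TensorProduct.smul_tmul', smul_eq_mul, Algebra.smul_def]
  rfl

end FrobPullback

/-! ### The sequence `0 → FΩ¹_A ⊗_A B → FΩ¹_B → F^*Ω¹_{B₁/A₁} → 0` -/

namespace FWDiff

variable (p : ℕ) [Fact p.Prime] (A B : Type*) [CommRing A] [CommRing B] [Algebra A B]

/-- The derivation `B → F^*Ω¹_{B₁/A₁}`, `b ↦ 1 ⊗ db`. -/
def dPullback (b : B) : FrobPullback p B (KaehlerModP p A B) :=
  FrobPullback.of p B (KaehlerModP.d p A B (Ideal.Quotient.mk (Ideal.span {(p : B)}) b))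

theorem dPullback_algebraMap (a : A) : dPullback p A B (algebraMap A B a) = 0 := by
  have h : KaehlerModP.d p A B (Ideal.Quotient.mk (Ideal.span {(p : B)}) (algebraMap A B a)) = 0 :=
    KaehlerModP.d_map p A B (Ideal.Quotient.mk (Ideal.span {(p : A)}) a)
  rw [dPullback, h, FrobPullback.of_zero]

theorem isFWDerivation_dPullback : IsFWDerivation p (dPullback p A B) where
  map_add a b := by
    have h : dPullback p A B (p : B) = 0 :=
      (congrArg (dPullback p A B) (map_natCast (algebraMap A B) p)).symm.trans
        (dPullback_algebraMap p A B p)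
    rw [h, smul_zero, sub_zero]
    simp only [dPullback, _root_.map_add, KaehlerModP.d_add, FrobPullback.of_add]
  map_mul a b := by
    have hs : ∀ (c : B) (m : FrobPullback p B (KaehlerModP p A B)),
        (Ideal.Quotient.mk (Ideal.span {(p : B)}) c : RingModP p B) ^ p • m = c ^ p • m := by
      intro c m
      rw [← map_pow]
      rfl
    simp only [dPullback, _root_.map_mul, KaehlerModP.d_mul, FrobPullback.of_add,
      FrobPullback.of_smul, hs]
    exact add_comm _ _

/-- The canonical map `FΩ¹_B → F^*Ω¹_{B₁/A₁}`, `w(b) ↦ 1 ⊗ db`. -/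
def toPullback : FWDiff p B →ₗ[B] FrobPullback p B (KaehlerModP p A B) :=
  lift (dPullback p A B) (isFWDerivation_dPullback p A B)

theorem toPullback_w (b : B) : toPullback p A B (w p B b) = dPullback p A B b :=
  lift_w _ _ _

theorem toPullback_map (x : FWDiff p A) : toPullback p A B (map p A B x) = 0 := by
  have hx : x ∈ Submodule.span A (Set.range (w p A)) := by
    rw [span_range_w]; exact Submodule.mem_top
  induction hx using Submodule.span_induction with
  | mem x hx =>
    obtain ⟨a, rfl⟩ := hx
    rw [map, lift_w, toPullback_w, dPullback_algebraMap]
  | zero => rw [map_zero, map_zero]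
  | add x y _ _ hx hy => rw [_root_.map_add, _root_.map_add, hx, hy, add_zero]
  | smul a x _ hx => rw [map_smul, ← algebraMap_smul B a, map_smul, hx, smul_zero]

theorem toPullback_comp_mapBaseChange : toPullback p A B ∘ₗ mapBaseChange p A B = 0 := by
  refine LinearMap.ext fun x => ?_
  induction x with
  | zero => rw [map_zero, map_zero]
  | add x y hx hy => rw [_root_.map_add, hx, hy, map_add]
  | tmul b x =>
    rw [LinearMap.comp_apply, mapBaseChange, LinearMap.liftBaseChange_tmul, map_smul,
      toPullback_map, smul_zero, LinearMap.zero_apply]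

/-- The cokernel of `FΩ¹_A ⊗_A B → FΩ¹_B`. -/
def Coker : Type _ :=
  FWDiff p B ⧸ LinearMap.range (mapBaseChange p A B)

instance : AddCommGroup (Coker p A B) :=
  inferInstanceAs (AddCommGroup (FWDiff p B ⧸ LinearMap.range (mapBaseChange p A B)))

instance : Module B (Coker p A B) :=
  inferInstanceAs (Module B (FWDiff p B ⧸ LinearMap.range (mapBaseChange p A B)))

/-- The `B`-linear map `Coker (FΩ¹_A ⊗_A B → FΩ¹_B) → F^*Ω¹_{B₁/A₁}` induced by
`FΩ¹_B → F^*Ω¹_{B₁/A₁}`. -/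
def cokerToPullback : Coker p A B →ₗ[B] FrobPullback p B (KaehlerModP p A B) :=
  (LinearMap.range (mapBaseChange p A B)).liftQ (toPullback p A B) <| by
    rw [LinearMap.range_le_ker_iff]
    exact toPullback_comp_mapBaseChange p A B

end FWDiff

/-! ### Rings over `ℤ_(p)` -/

instance intSpanIsPrime (p : ℕ) [hp : Fact p.Prime] : (Ideal.span {(p : ℤ)}).IsPrime :=
  (Ideal.span_singleton_prime (by exact_mod_cast hp.out.ne_zero)).mpr
    (Nat.prime_iff_prime_int.mp hp.out)

/-- The localization `ℤ_(p)` of `ℤ` at the prime ideal `(p)`. -/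
abbrev ZLoc (p : ℕ) [Fact p.Prime] : Type :=
  Localization.AtPrime (Ideal.span {(p : ℤ)})

namespace FWDiff

variable (p : ℕ) [hp : Fact p.Prime]

/-- Over `ℤ_(p)`, multiplication by `p` is zero on Frobenius-Witt differentials. -/
theorem natCast_smul_w (A : Type*) [CommRing A] [Algebra (ZLoc p) A] (a : A) :
    (p : A) • w p A a = 0 := by
  have hD := isFWDerivation_w p A
  have hP0 : ∀ x : A, FW.P p 0 x = 0 := fun x => by
    refine Finset.sum_eq_zero fun i hi => ?_
    rw [zero_pow (by have := (Finset.mem_Icc.mp hi).1; omega)]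
    ring
  have h0 : w p A 0 = 0 := by
    have := hD.map_add 0 0
    rw [hP0, zero_smul, sub_zero, add_zero] at this
    exact left_eq_add.mp this
  have h1 : w p A 1 = 0 := by
    have := hD.map_mul 1 1
    rw [one_pow, one_smul, mul_one] at this
    exact left_eq_add.mp this
  have hn : ∀ n : ℕ, w p A (n * a) = (n : A) • w p A a + a ^ p • w p A (n : A) := by
    intro n
    induction n with
    | zero => simp [h0]
    | succ n ih =>
      have e1 := hD.map_add (n * a) a
      have e2 := hD.map_add (n : A) 1
      have e3 : FW.P p (n * a) a = a ^ p * FW.P p (n : A) 1 := by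
        rw [← FW.P_mul_mul, one_mul]
      rw [e3, ih] at e1
      push_cast
      rw [add_mul, one_mul, e1, e2, h1]
      module
  have e := (hn p).symm.trans (hD.map_mul p a)
  have e' : ((p : A) - (p : A) ^ p) • w p A a = 0 := by
    rw [sub_smul, sub_eq_zero]
    rw [add_comm] at e
    exact add_left_cancel e
  have hu : IsUnit (1 - (p : A) ^ (p - 1)) := by
    have h2 : (1 - (p : ℤ) ^ (p - 1)) ∈ (Ideal.span {(p : ℤ)}).primeCompl := by
      intro h3
      have h4 : (p : ℤ) ^ (p - 1) ∈ Ideal.span {(p : ℤ)} :=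
        Ideal.pow_mem_of_mem _ (Ideal.mem_span_singleton_self _) _
          (by have := hp.out.one_lt; omega)
      have h5 := Ideal.add_mem _ h3 h4
      rw [sub_add_cancel] at h5
      exact (intSpanIsPrime p).ne_top ((Ideal.eq_top_iff_one _).mpr h5)
    have h6 := (IsLocalization.map_units (ZLoc p) ⟨_, h2⟩).map (algebraMap (ZLoc p) A)
    simpa using h6
  have h7 : (p : A) - (p : A) ^ p = (1 - (p : A) ^ (p - 1)) * p := by
    rw [sub_mul, one_mul, pow_sub_one_mul hp.out.ne_zero]
  rw [h7, mul_smul] at e'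
  exact hu.smul_eq_zero.mp e'

theorem natCast_smul (A : Type*) [CommRing A] [Algebra (ZLoc p) A] (x : FWDiff p A) :
    (p : A) • x = 0 := by
  have h : LinearMap.lsmul A (FWDiff p A) (p : A) = 0 :=
    hom_ext fun a => natCast_smul_w p A a
  exact DFunLike.congr_fun h x

variable (A B : Type*) [CommRing A] [CommRing B] [Algebra A B] [Algebra (ZLoc p) B]

theorem Coker.isTorsionBySet :
    Module.IsTorsionBySet B (Coker p A B) (Ideal.span {(p : B)} : Ideal B) := by
  rw [Module.isTorsionBySet_span_singleton_iff]
  intro x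
  obtain ⟨y, rfl⟩ := (LinearMap.range (mapBaseChange p A B)).mkQ_surjective x
  have h := congrArg (LinearMap.range (mapBaseChange p A B)).mkQ (natCast_smul p B y)
  rw [map_smul, map_zero] at h
  exact h

/-- The cokernel of `FΩ¹_A ⊗_A B → FΩ¹_B` is killed by `p`, so it is a `B₁`-module. -/
instance : Module (RingModP p B) (Coker p A B) :=
  (Coker.isTorsionBySet p A B).module

/-- The `B₁`-module structure of the cokernel is the one that induces its `B`-module structure. -/
instance : IsScalarTower B (RingModP p B) (Coker p A B) :=
  (Coker.isTorsionBySet p A B).isScalarTower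

end FWDiff

/-! ### Split exact sequences -/

/-- The sequence `0 → M → N → Q → 0` of `R`-modules is exact and splits. -/
structure IsSplitExact {R M N Q : Type*} [Ring R] [AddCommGroup M] [AddCommGroup N]
    [AddCommGroup Q] [Module R M] [Module R N] [Module R Q]
    (f : M →ₗ[R] N) (g : N →ₗ[R] Q) : Prop where
  injective : Function.Injective f
  exact : Function.Exact f g
  surjective : Function.Surjective g
  split : ∃ s : Q →ₗ[R] N, g ∘ₗ s = LinearMap.id

end

/-! On a module killed by `p`, a Frobenius-Witt derivation `w` with `w p = μ` is the same as a ring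
section of a square-zero extension `FWExt`, whose addition is twisted by `P` and `μ` and whose
multiplication is twisted by Frobenius. The infinitesimal lifting property therefore extends such
derivations along a smooth `A → B`; extending `a ↦ 1 ⊗ w a` gives a retraction of `FΩ¹_A ⊗ B →
FΩ¹_B`. The rest of the sequence is exact for every `A → B`: in the cokernel `w p = 0`, so `w` is
additive and is an `A₁`-derivation of `B₁` once `B₁` acts through Frobenius. The cokernel is thus
`F^*Ω¹` (`cokerToPullback_bijective`).

For the converse, write `S = B_𝔮` as a quotient `P/I`, with `P` a localized polynomial ring over
`A`; `P` is regular. Let `k` be the residue field of `S`. By the Jacobian criterion it suffices that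
`k ⊗ I → k ⊗ Ω_{P/A}` is injective. Let `y ∈ I` have `1 ⊗ dy = 0`. As `P` and `P/I` are regular,
`I/𝔪I` embeds in `𝔪/𝔪²` (`mem_mul_of_mem_sq`), so only `y ∈ 𝔪²` is needed. If it fails, some linear
form `φ` on `𝔪/𝔪²` has `φ y ≠ 0`, and some Frobenius-Witt derivation `w` of `P` equals `φ ^ p` on
`𝔪` (`exists_isFWDerivation_eq_pow`). By splitness, `w|_A` extends to a derivation `D` of `S`. Then
`w - D` vanishes on `A`, hence factors through `Ω_{P/A}` and kills `y`; since `D y = 0`, this gives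
`φ y ^ p = 0`, a contradiction. -/

noncomputable section

/-! ### Polynomial identities for `P`. -/

namespace FW

variable (p : ℕ) {A : Type*} [CommRing A]

theorem P_zero_left (a : A) : P p 0 a = 0 := by
  refine Finset.sum_eq_zero fun i hi => ?_
  rw [zero_pow (by have := (Finset.mem_Icc.mp hi).1; omega)]
  ring

variable [hp : Fact p.Prime]

/-- The identity is universal, and `p` is a nonzerodivisor in `ℤ[X, Y]`, so it may be checked after
multiplying by `p`, where `mul_P` makes it elementary. -/
theorem P_comm (a b : A) : P p a b = P p b a := by
  have key : P p (MvPolynomial.X 0 : MvPolynomial (Fin 2) ℤ) (MvPolynomial.X 1)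
      = P p (MvPolynomial.X 1) (MvPolynomial.X 0) := by
    have hp0 : (p : MvPolynomial (Fin 2) ℤ) ≠ 0 := by exact_mod_cast hp.out.ne_zero
    refine mul_left_cancel₀ hp0 ?_
    rw [mul_P, mul_P]
    ring
  have h := congrArg (MvPolynomial.aeval ![a, b]).toRingHom key
  rw [P_map, P_map] at h
  simpa using h

/-- The cocycle identity behind associativity of addition in `FWExt`, again checked universally
after multiplying by `p`. -/
theorem P_add_P_add (a b c : A) : P p a b + P p (a + b) c = P p b c + P p a (b + c) := by
  have key : P p (MvPolynomial.X 0 : MvPolynomial (Fin 3) ℤ) (MvPolynomial.X 1)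
        + P p (MvPolynomial.X 0 + MvPolynomial.X 1) (MvPolynomial.X 2)
      = P p (MvPolynomial.X 1) (MvPolynomial.X 2)
        + P p (MvPolynomial.X 0) (MvPolynomial.X 1 + MvPolynomial.X 2) := by
    have hp0 : (p : MvPolynomial (Fin 3) ℤ) ≠ 0 := by exact_mod_cast hp.out.ne_zero
    refine mul_left_cancel₀ hp0 ?_
    rw [mul_add, mul_add, mul_P, mul_P, mul_P, mul_P]
    ring
  have h := congrArg (MvPolynomial.aeval ![a, b, c]).toRingHom key
  rw [map_add, map_add, P_map, P_map, P_map, P_map] at h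
  simpa using h

theorem add_pow_smul {M : Type*} [AddCommGroup M] [Module A M] (hM : ∀ m : M, (p : A) • m = 0)
    (a b : A) (m : M) : (a + b) ^ p • m = a ^ p • m + b ^ p • m := by
  have h : (a + b) ^ p = a ^ p + b ^ p + p * P p a b := by rw [mul_P]; ring
  rw [h, add_smul, add_smul, mul_comm, mul_smul, hM, smul_zero, add_zero]

end FW

namespace IsFWDerivation

variable {p : ℕ} {A M : Type*} [CommRing A] [AddCommGroup M] [Module A M] {w : A → M}

theorem map_zero (hw : IsFWDerivation p w) : w 0 = 0 := by
  have := hw.map_add 0 0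
  rw [FW.P_zero_left, zero_smul, sub_zero, add_zero] at this
  exact left_eq_add.mp this

theorem map_one (hw : IsFWDerivation p w) : w 1 = 0 := by
  have := hw.map_mul 1 1
  rw [one_pow, one_smul, mul_one] at this
  exact left_eq_add.mp this

theorem linearMap_comp {N : Type*} [AddCommGroup N] [Module A N] (hw : IsFWDerivation p w)
    (g : M →ₗ[A] N) : IsFWDerivation p (fun a => g (w a)) where
  map_add a b := by simp [hw.map_add]
  map_mul a b := by simp [hw.map_mul]

end IsFWDerivation

/-! ### The extension ring classifying Frobenius-Witt derivations. -/

/-- The square-zero extension of `B` by a `B`-module `M` killed by `p` whose ring sections are the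
Frobenius-Witt derivations `w : B → M` with `w p = μ`. -/
@[ext]
structure FWExt (p : ℕ) {B M : Type*} [CommRing B] [AddCommGroup M] [Module B M] (μ : M)
    (hM : ∀ m : M, (p : B) • m = 0) where
  fst : B
  snd : M

namespace FWExt

variable {p : ℕ} {B M : Type*} [CommRing B] [AddCommGroup M] [Module B M] {μ : M}
  {hM : ∀ m : M, (p : B) • m = 0}

instance : Zero (FWExt p μ hM) := ⟨⟨0, 0⟩⟩
instance : One (FWExt p μ hM) := ⟨⟨1, 0⟩⟩
instance : Add (FWExt p μ hM) :=
  ⟨fun x y => ⟨x.fst + y.fst, x.snd + y.snd - FW.P p x.fst y.fst • μ⟩⟩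
instance : Mul (FWExt p μ hM) :=
  ⟨fun x y => ⟨x.fst * y.fst, y.fst ^ p • x.snd + x.fst ^ p • y.snd⟩⟩
instance : Neg (FWExt p μ hM) :=
  ⟨fun x => ⟨-x.fst, FW.P p (-x.fst) x.fst • μ - x.snd⟩⟩

@[simp] theorem zero_fst : (0 : FWExt p μ hM).fst = 0 := rfl
@[simp] theorem zero_snd : (0 : FWExt p μ hM).snd = 0 := rfl
@[simp] theorem one_fst : (1 : FWExt p μ hM).fst = 1 := rfl
@[simp] theorem one_snd : (1 : FWExt p μ hM).snd = 0 := rfl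
@[simp] theorem add_fst (x y : FWExt p μ hM) : (x + y).fst = x.fst + y.fst := rfl
theorem add_snd (x y : FWExt p μ hM) :
    (x + y).snd = x.snd + y.snd - FW.P p x.fst y.fst • μ := rfl
@[simp] theorem mul_fst (x y : FWExt p μ hM) : (x * y).fst = x.fst * y.fst := rfl
theorem mul_snd (x y : FWExt p μ hM) :
    (x * y).snd = y.fst ^ p • x.snd + x.fst ^ p • y.snd := rfl
@[simp] theorem neg_fst (x : FWExt p μ hM) : (-x).fst = -x.fst := rfl
theorem neg_snd (x : FWExt p μ hM) : (-x).snd = FW.P p (-x.fst) x.fst • μ - x.snd := rfl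

variable [hp : Fact p.Prime]

instance : CommRing (FWExt p μ hM) where
  add_assoc x y z := by
    ext
    · simp [add_assoc]
    · have h := congrArg (· • μ) (FW.P_add_P_add p x.fst y.fst z.fst)
      simp only [add_smul] at h
      simp only [add_snd, add_fst]
      rw [← sub_eq_zero] at h ⊢
      rw [← neg_eq_zero, ← h]
      abel
  zero_add x := by ext <;> simp [add_snd, FW.P_zero_left]
  add_zero x := by
    ext <;> simp [add_snd, FW.P_comm p _ (0 : B), FW.P_zero_left]
  add_comm x y := by
    ext
    · simp [add_comm]
    · simp only [add_snd, FW.P_comm p x.fst]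
      abel
  left_distrib x y z := by
    ext
    · simp [mul_add]
    · simp only [mul_snd, add_snd, add_fst, mul_fst, FW.add_pow_smul p hM]
      rw [mul_comm x.fst, mul_comm x.fst, FW.P_mul_mul, mul_smul]
      module
  right_distrib x y z := by
    ext
    · simp [add_mul]
    · simp only [mul_snd, add_snd, add_fst, mul_fst, FW.add_pow_smul p hM]
      rw [FW.P_mul_mul, mul_smul]
      module
  zero_mul x := by ext <;> simp [mul_snd, hp.out.ne_zero]
  mul_zero x := by ext <;> simp [mul_snd, hp.out.ne_zero]
  mul_assoc x y z := by
    ext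
    · simp [mul_assoc]
    · simp only [mul_snd, mul_fst, mul_pow]
      module
  one_mul x := by ext <;> simp [mul_snd]
  mul_one x := by ext <;> simp [mul_snd]
  mul_comm x y := by
    ext
    · simp [mul_comm]
    · simp only [mul_snd, add_comm]
  neg_add_cancel x := by
    ext
    · simp
    · simp [add_snd, neg_snd]
  nsmul := nsmulRec
  zsmul := zsmulRec

/-- The projection of the extension onto `B`. -/
def fstHom : FWExt p μ hM →+* B where
  toFun := fst
  map_one' := rfl
  map_mul' _ _ := rfl
  map_zero' := rfl
  map_add' _ _ := rfl

@[simp] theorem fstHom_apply (x : FWExt p μ hM) : fstHom x = x.fst := rfl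

-- The section `b ↦ (b, 0)` is multiplicative, though in general not additive.
@[simp] theorem mk_zero_pow (b : B) (n : ℕ) : (⟨b, 0⟩ : FWExt p μ hM) ^ n = ⟨b ^ n, 0⟩ := by
  induction n with
  | zero => ext <;> simp
  | succ n ih => rw [pow_succ, ih]; ext <;> simp [mul_snd, pow_succ]

section

variable {A : Type*} [CommRing A] [Algebra A B] [Module A M] [IsScalarTower A B M]

/-- The ring morphism `a ↦ (a, w a)` attached to a Frobenius-Witt derivation `w`. -/
def ofDerivation {w : A → M} (hw : IsFWDerivation p w) : A →+* FWExt p (w p) hM where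
  toFun a := ⟨algebraMap A B a, w a⟩
  map_one' := by ext <;> simp [hw.map_one]
  map_mul' a b := by ext <;> simp [mul_snd, hw.map_mul, ← map_pow]
  map_zero' := by ext <;> simp [hw.map_zero]
  map_add' a b := by ext <;> simp [add_snd, hw.map_add, ← FW.P_map]

/-- Converse to `ofDerivation`; `h2` identifies the parameter `μ` of the addition law with the value
at `p`. -/
theorem isFWDerivation_snd (h : A →+* FWExt p μ hM) (h1 : ∀ a, (h a).fst = algebraMap A B a)
    (h2 : (h p).snd = μ) : IsFWDerivation p (fun a => (h a).snd) where
  map_add a b := by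
    rw [map_add, add_snd, h2, h1, h1, ← FW.P_map, algebraMap_smul]
  map_mul a b := by
    rw [map_mul, mul_snd, h1, h1, ← map_pow, ← map_pow, algebraMap_smul, algebraMap_smul]

end

end FWExt

/-- A Frobenius-Witt derivation extends along a formally smooth morphism. -/
theorem IsFWDerivation.exists_extension {p : ℕ} [hp : Fact p.Prime] {A B M : Type*} [CommRing A]
    [CommRing B] [Algebra A B] [Algebra.FormallySmooth A B] [AddCommGroup M] [Module A M]
    [Module B M] [IsScalarTower A B M] (hM : ∀ m : M, (p : B) • m = 0) {w : A → M}
    (hw : IsFWDerivation p w) :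
    ∃ D : B → M, IsFWDerivation p D ∧ ∀ a, D (algebraMap A B a) = w a := by
  let _ : Algebra A (FWExt p (w p) hM) := (FWExt.ofDerivation hw).toAlgebra
  let g : FWExt p (w p) hM →ₐ[A] B := { FWExt.fstHom with commutes' := fun a => rfl }
  have hg : Function.Surjective g := fun b => ⟨⟨b, 0⟩, rfl⟩
  -- Each term of a product carries the `p`-th power of a first component, so the kernel has square
  -- zero.
  have hker : IsNilpotent (RingHom.ker (g : FWExt p (w p) hM →+* B)) := by
    refine ⟨2, ?_⟩
    rw [pow_two, Ideal.zero_eq_bot, eq_bot_iff, Ideal.mul_le]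
    intro x hx y hy
    have hx' : x.fst = 0 := hx
    have hy' : y.fst = 0 := hy
    rw [Ideal.mem_bot]
    ext <;> simp [FWExt.mul_snd, hx', hy', hp.out.ne_zero]
  let h : B →ₐ[A] FWExt p (w p) hM :=
    Algebra.FormallySmooth.liftOfSurjective (AlgHom.id A B) g hg hker
  have h1 : ∀ b, (h b).fst = b :=
    Algebra.FormallySmooth.liftOfSurjective_apply (AlgHom.id A B) g hg hker
  have h2 : ∀ a, (h (algebraMap A B a)).snd = w a := fun a => by
    rw [h.commutes]
    rfl
  refine ⟨fun b => (h b).snd, ?_, h2⟩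
  refine FWExt.isFWDerivation_snd (A := B) h.toRingHom h1 ?_
  have := h2 p
  rwa [map_natCast] at this

/-- An `S`-module `M`, regarded as an `R`-module along a ring morphism `φ : R → S`. -/
def RestrictAlong {R S : Type*} [CommRing R] [CommRing S] (_φ : R →+* S) (M : Type*) : Type _ := M

namespace RestrictAlong

variable {R S : Type*} [CommRing R] [CommRing S] (φ : R →+* S) (M : Type*) [AddCommGroup M]
  [Module S M]

instance : AddCommGroup (RestrictAlong φ M) := inferInstanceAs (AddCommGroup M)

instance : Module R (RestrictAlong φ M) := Module.compHom M φ

/-- The identity of `M`, with values in the restriction of scalars. -/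
def of : M ≃+ RestrictAlong φ M := AddEquiv.refl M

end RestrictAlong

/-- A short exact sequence with a retraction is split exact. -/
theorem IsSplitExact.of_retraction {R M N Q : Type*} [Ring R] [AddCommGroup M] [AddCommGroup N]
    [AddCommGroup Q] [Module R M] [Module R N] [Module R Q] {f : M →ₗ[R] N} {g : N →ₗ[R] Q}
    (hfg : Function.Exact f g) (hg : Function.Surjective g) {r : N →ₗ[R] M}
    (hr : r ∘ₗ f = LinearMap.id) : IsSplitExact f g where
  injective := Function.LeftInverse.injective (g := r) fun x => DFunLike.congr_fun hr x
  exact := hfg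
  surjective := hg
  split := by
    have h := hfg.split_tfae'.out 1 0
    exact (h.mp ⟨hg, r, hr⟩).2

theorem IsSplitExact.exists_retraction {R M N Q : Type*} [Ring R] [AddCommGroup M] [AddCommGroup N]
    [AddCommGroup Q] [Module R M] [Module R N] [Module R Q] {f : M →ₗ[R] N} {g : N →ₗ[R] Q}
    (h : IsSplitExact f g) : ∃ r : N →ₗ[R] M, r ∘ₗ f = LinearMap.id := by
  have h' := h.exact.split_tfae'.out 0 1
  exact (h'.mp ⟨h.injective, h.split⟩).2

/-! ### The cokernel as a Frobenius pullback, and splitting in the smooth case. -/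

namespace FWDiff

variable (p : ℕ) (A B : Type*) [CommRing A] [CommRing B] [Algebra A B]

/-- The class of `w(b)` in the cokernel of `FΩ¹_A ⊗_A B → FΩ¹_B`. -/
def cokerW (b : B) : Coker p A B :=
  (LinearMap.range (mapBaseChange p A B)).mkQ (w p B b)

theorem isFWDerivation_cokerW : IsFWDerivation p (cokerW p A B) :=
  (isFWDerivation_w p B).linearMap_comp (LinearMap.range (mapBaseChange p A B)).mkQ

theorem cokerW_algebraMap (a : A) : cokerW p A B (algebraMap A B a) = 0 := by
  refine (Submodule.Quotient.mk_eq_zero _).mpr ⟨1 ⊗ₜ w p A a, ?_⟩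
  rw [mapBaseChange_tmul_w, one_smul]

/-- Since `p` comes from `A`, its differential dies; this removes the `P`-term and makes `w`
additive on the cokernel. -/
theorem cokerW_natCast : cokerW p A B (p : B) = 0 := by
  rw [← map_natCast (algebraMap A B), cokerW_algebraMap]

theorem cokerW_add (a b : B) : cokerW p A B (a + b) = cokerW p A B a + cokerW p A B b := by
  rw [(isFWDerivation_cokerW p A B).map_add, cokerW_natCast, smul_zero, sub_zero]

theorem span_range_cokerW : Submodule.span B (Set.range (cokerW p A B)) = ⊤ := by
  have h := congrArg (Submodule.map (LinearMap.range (mapBaseChange p A B)).mkQ)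
    (span_range_w (A := B) p)
  rw [Submodule.map_span, Submodule.map_top, Submodule.range_mkQ, ← Set.range_comp] at h
  exact h

variable [hp : Fact p.Prime]

theorem cokerToPullback_cokerW (b : B) :
    cokerToPullback p A B (cokerW p A B b) = dPullback p A B b :=
  toPullback_w p A B b

/-- The elements `1 ⊗ db` generate: a coefficient inside `Ω` moves out as its `p`-th power, so the
range absorbs it. -/
theorem toPullback_surjective : Function.Surjective (toPullback p A B) := by
  rw [← LinearMap.range_eq_top, eq_top_iff]
  rintro x -
  let _ : Algebra (RingModP p A) (RingModP p B) := (RingModP.map p A B).toAlgebra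
  change FrobTwist p B ⊗[RingModP p B] Ω[RingModP p B⁄RingModP p A] at x
  induction x using TensorProduct.induction_on with
  | zero => exact Submodule.zero_mem _
  | add x y hx hy => exact Submodule.add_mem _ hx hy
  | tmul c m =>
    obtain ⟨c, rfl⟩ := Ideal.Quotient.mk_surjective (I := Ideal.span {(p : B)}) c
    have hm : m ∈ Submodule.span (RingModP p B)
        (Set.range (KaehlerDifferential.D (RingModP p A) (RingModP p B))) := by
      rw [KaehlerDifferential.span_range_derivation]
      exact Submodule.mem_top
    have hc : ∀ m : Ω[RingModP p B⁄RingModP p A],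
        ((show FrobTwist p B from Ideal.Quotient.mk (Ideal.span {(p : B)}) c) ⊗ₜ[RingModP p B] m :
          FrobTwist p B ⊗[RingModP p B] Ω[RingModP p B⁄RingModP p A])
        = c • FrobPullback.of p B (M := KaehlerModP p A B) m := by
      intro m
      change _ = (show FrobTwist p B from Ideal.Quotient.mk (Ideal.span {(p : B)}) c)
        • ((1 : FrobTwist p B) ⊗ₜ[RingModP p B] m)
      rw [TensorProduct.smul_tmul', smul_eq_mul, mul_one]
    refine (congrArg (· ∈ LinearMap.range (toPullback p A B)) (hc m)).mpr ?_
    refine Submodule.smul_mem _ _ ?_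
    induction hm using Submodule.span_induction with
    | mem m hm =>
      obtain ⟨b, rfl⟩ := hm
      obtain ⟨b, rfl⟩ := Ideal.Quotient.mk_surjective b
      exact ⟨w p B b, toPullback_w p A B b⟩
    | zero =>
      rw [FrobPullback.of_zero]
      exact Submodule.zero_mem _
    | add m n _ _ hm hn =>
      rw [FrobPullback.of_add]
      exact Submodule.add_mem _ hm hn
    | smul b m _ hm =>
      obtain ⟨b, rfl⟩ := Ideal.Quotient.mk_surjective b
      rw [FrobPullback.of_smul, ← map_pow]
      exact Submodule.smul_mem _ (b ^ p) hm

section Inverse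

variable [Algebra (ZLoc p) B]

theorem cokerW_natCast_mul (b : B) : cokerW p A B (p * b) = 0 := by
  have h : (p : B) • cokerW p A B b = 0 :=
    @(Module.isTorsionBySet_span_singleton_iff _).mp (Coker.isTorsionBySet p A B) (cokerW p A B b)
  rw [(isFWDerivation_cokerW p A B).map_mul, cokerW_natCast, smul_zero, zero_add,
    ← pow_sub_one_mul hp.out.ne_zero, mul_smul, h, smul_zero]

/-- The additive map `B/pB → Coker` induced by `w`. -/
def cokerD : RingModP p B →+ Coker p A B :=
  QuotientAddGroup.lift (Ideal.span {(p : B)}).toAddSubgroup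
    (AddMonoidHom.mk' (cokerW p A B) (cokerW_add p A B)) <| by
      intro x hx
      obtain ⟨b, rfl⟩ := Ideal.mem_span_singleton'.mp hx
      rw [mul_comm]
      exact cokerW_natCast_mul p A B b

theorem cokerD_mk (b : B) : cokerD p A B (Ideal.Quotient.mk _ b) = cokerW p A B b := rfl

instance : Module (FrobTwist p B) (Coker p A B) :=
  inferInstanceAs (Module (RingModP p B) (Coker p A B))

/-- The cokernel with `B/pB` acting through the Frobenius. -/
abbrev CokerFrob : Type _ :=
  RestrictAlong (algebraMap (RingModP p B) (FrobTwist p B)) (Coker p A B)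

/-- `FrobTwist p B` keeps the original action while `RingModP p B` acts through Frobenius, so a
linear map from `Ω` to this module extends to `F^*Ω`. -/
instance : Module (FrobTwist p B) (CokerFrob p A B) :=
  inferInstanceAs (Module (FrobTwist p B) (Coker p A B))

instance : IsScalarTower (RingModP p B) (FrobTwist p B) (CokerFrob p A B) where
  smul_assoc b x m := by
    rw [Algebra.smul_def, mul_smul]
    rfl

theorem mk_smul_coker (b : B) (x : Coker p A B) :
    (Ideal.Quotient.mk (Ideal.span {(p : B)}) b : RingModP p B) • x = b • x := rfl

theorem cokerD_mul (x y : RingModP p B) :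
    cokerD p A B (x * y) = y ^ p • cokerD p A B x + x ^ p • cokerD p A B y := by
  obtain ⟨x, rfl⟩ := Ideal.Quotient.mk_surjective x
  obtain ⟨y, rfl⟩ := Ideal.Quotient.mk_surjective y
  rw [← map_mul, ← map_pow, ← map_pow, cokerD_mk, cokerD_mk, cokerD_mk, mk_smul_coker,
    mk_smul_coker]
  exact (isFWDerivation_cokerW p A B).map_mul x y

/-- The inverse of `cokerToPullback`. With `B₁` acting through Frobenius, the product rule for `w`
is the Leibniz rule, so the universal property of `Ω` applies. -/
theorem exists_pullbackToCoker :
    ∃ ψ : FrobPullback p B (KaehlerModP p A B) →+ Coker p A B,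
      (∀ (b : B) x, ψ (b • x) = b • ψ x) ∧ ∀ b, ψ (dPullback p A B b) = cokerW p A B b := by
  let _ : Algebra (RingModP p A) (RingModP p B) := (RingModP.map p A B).toAlgebra
  let _ : Module (RingModP p A) (CokerFrob p A B) :=
    Module.compHom _ (algebraMap (RingModP p A) (RingModP p B))
  have : IsScalarTower (RingModP p A) (RingModP p B) (CokerFrob p A B) :=
    ⟨fun a b x => by rw [Algebra.smul_def, mul_smul]; rfl⟩
  let N := RestrictAlong.of (algebraMap (RingModP p B) (FrobTwist p B)) (Coker p A B)
  have hmul : ∀ x y : RingModP p B, N (cokerD p A B (x * y))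
      = x • N (cokerD p A B y) + y • N (cokerD p A B x) := by
    intro x y
    rw [cokerD_mul, map_add, add_comm]
    rfl
  have hone : N (cokerD p A B 1) = 0 := by
    have := hmul 1 1
    rw [one_smul, mul_one] at this
    exact left_eq_add.mp this
  have hA : ∀ a : RingModP p A, N (cokerD p A B (algebraMap _ _ a)) = 0 := by
    intro a
    obtain ⟨a, rfl⟩ := Ideal.Quotient.mk_surjective a
    exact congrArg N (cokerW_algebraMap p A B a)
  let D : Derivation (RingModP p A) (RingModP p B) (CokerFrob p A B) :=
    { toFun := fun x => N (cokerD p A B x)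
      map_add' := fun x y => by rw [map_add, map_add]
      map_smul' := fun a x => by
        rw [Algebra.smul_def, hmul, hA, smul_zero, add_zero, algebraMap_smul, RingHom.id_apply]
      map_one_eq_zero' := hone
      leibniz' := hmul }
  let ψ : FrobTwist p B ⊗[RingModP p B] Ω[RingModP p B⁄RingModP p A]
      →ₗ[FrobTwist p B] CokerFrob p A B := D.liftKaehlerDifferential.liftBaseChange _
  refine ⟨(N.symm : CokerFrob p A B →+ Coker p A B).comp ψ.toAddMonoidHom, ?_, ?_⟩
  · intro b x
    exact ψ.map_smul (show FrobTwist p B from Ideal.Quotient.mk _ b) x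
  · intro b
    have : ψ (1 ⊗ₜ KaehlerDifferential.D _ _ (Ideal.Quotient.mk _ b))
        = N (cokerW p A B b) := by
      rw [LinearMap.liftBaseChange_tmul, one_smul, Derivation.liftKaehlerDifferential_comp_D]
      rfl
    exact this

/-- No smoothness enters: both sides represent the Frobenius-Witt derivations of `B` that vanish on
`A`. -/
theorem cokerToPullback_bijective : Function.Bijective (cokerToPullback p A B) := by
  constructor
  · obtain ⟨ψ, h1, h2⟩ := exists_pullbackToCoker p A B
    refine Function.LeftInverse.injective (g := ψ) fun x => ?_
    have hx : x ∈ Submodule.span B (Set.range (cokerW p A B)) := by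
      rw [span_range_cokerW]; exact Submodule.mem_top
    induction hx using Submodule.span_induction with
    | mem x hx =>
      obtain ⟨b, rfl⟩ := hx
      rw [cokerToPullback_cokerW, h2]
    | zero => rw [_root_.map_zero, _root_.map_zero]
    | add x y _ _ hx hy => rw [_root_.map_add, _root_.map_add, hx, hy]
    | smul a x _ hx => rw [map_smul, h1, hx]
  · intro x
    obtain ⟨y, rfl⟩ := toPullback_surjective p A B x
    exact ⟨(LinearMap.range (mapBaseChange p A B)).mkQ y, rfl⟩

theorem exact_mapBaseChange_toPullback :
    Function.Exact (mapBaseChange p A B) (toPullback p A B) := by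
  intro x
  constructor
  · intro hx
    have : (LinearMap.range (mapBaseChange p A B)).mkQ x = 0 :=
      (cokerToPullback_bijective p A B).1
        (hx.trans (_root_.map_zero (cokerToPullback p A B)).symm)
    exact (Submodule.Quotient.mk_eq_zero _).mp this
  · rintro ⟨x, rfl⟩
    exact DFunLike.congr_fun (toPullback_comp_mapBaseChange p A B) x

/-- The derivation `a ↦ 1 ⊗ w a` of `A` extends to `B`, and the linear map that the extension
induces on `FΩ¹_B` is a retraction. -/
theorem isSplitExact_of_formallySmooth [Algebra (ZLoc p) A] [Algebra.FormallySmooth A B] :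
    IsSplitExact (mapBaseChange p A B) (toPullback p A B) := by
  have hM : ∀ m : B ⊗[A] FWDiff p A, (p : B) • m = 0 := by
    intro m
    induction m with
    | zero => exact smul_zero _
    | add x y hx hy => rw [smul_add, hx, hy, add_zero]
    | tmul b x =>
      rw [← map_natCast (algebraMap A B), algebraMap_smul, ← TensorProduct.tmul_smul,
        natCast_smul, TensorProduct.tmul_zero]
  have hw : IsFWDerivation p (fun a : A => (1 : B) ⊗ₜ[A] w p A a) :=
    (isFWDerivation_w p A).linearMap_comp (TensorProduct.mk A B (FWDiff p A) 1)
  obtain ⟨D, hD, hDw⟩ := hw.exists_extension hM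
  refine .of_retraction (exact_mapBaseChange_toPullback p A B) (toPullback_surjective p A B)
    (r := lift D hD) ?_
  refine TensorProduct.AlgebraTensorModule.ext fun b x => ?_
  have hx : x ∈ Submodule.span A (Set.range (w p A)) := by
    rw [span_range_w]; exact Submodule.mem_top
  induction hx using Submodule.span_induction with
  | mem x hx =>
    obtain ⟨a, rfl⟩ := hx
    rw [LinearMap.comp_apply, mapBaseChange_tmul_w, map_smul, lift_w, hDw,
      TensorProduct.smul_tmul', smul_eq_mul, mul_one, LinearMap.id_apply]
  | zero => rw [TensorProduct.tmul_zero, _root_.map_zero, _root_.map_zero]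
  | add x y _ _ hx hy => rw [TensorProduct.tmul_add, _root_.map_add, hx, hy, _root_.map_add]
  | smul a x _ hx =>
    rw [TensorProduct.tmul_smul, ← algebraMap_smul B a, map_smul, hx, map_smul]

end Inverse

end FWDiff

/-! ### Projectivity and finiteness of the pullback. -/

theorem RingModP.formallySmooth_map (p : ℕ) (A B : Type*) [CommRing A] [CommRing B] [Algebra A B]
    [Algebra.FormallySmooth A B] :
    letI : Algebra (RingModP p A) (RingModP p B) := (RingModP.map p A B).toAlgebra
    Algebra.FormallySmooth (RingModP p A) (RingModP p B) := by
  let _ : Algebra (RingModP p A) (RingModP p B) := (RingModP.map p A B).toAlgebra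
  refine Algebra.FormallySmooth.of_comp_surjective fun C _ _ I hI g => ?_
  let _ : Algebra A C := ((algebraMap (RingModP p A) C).comp (algebraMap A (RingModP p A))).toAlgebra
  have : IsScalarTower A (RingModP p A) C := .of_algebraMap_eq fun a => rfl
  have : IsScalarTower A (RingModP p A) (RingModP p B) := .of_algebraMap_eq fun a => rfl
  obtain ⟨f, hf⟩ := Algebra.FormallySmooth.comp_surjective A B I hI
    ((g.restrictScalars A).comp (IsScalarTower.toAlgHom A B (RingModP p B)))
  -- `C` is an algebra over `A/pA`, so any lift from `B` kills `p` and descends to `B/pB`.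
  have hp : ∀ x ∈ Ideal.span {(p : B)}, f x = 0 := by
    intro x hx
    obtain ⟨b, rfl⟩ := Ideal.mem_span_singleton'.mp hx
    rw [map_mul, map_natCast, ← map_natCast (algebraMap (RingModP p A) C),
      RingModP.natCast_eq_zero, map_zero, mul_zero]
  refine ⟨{ Ideal.Quotient.lift _ (f : B →+* C) hp with commutes' := ?_ }, ?_⟩
  · intro a
    obtain ⟨a, rfl⟩ := Ideal.Quotient.mk_surjective a
    exact f.commutes a
  · refine AlgHom.ext fun x => ?_
    obtain ⟨x, rfl⟩ := Ideal.Quotient.mk_surjective x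
    exact DFunLike.congr_fun hf x

theorem RingModP.finiteType_map (p : ℕ) (A B : Type*) [CommRing A] [CommRing B] [Algebra A B]
    [Algebra.FiniteType A B] :
    letI : Algebra (RingModP p A) (RingModP p B) := (RingModP.map p A B).toAlgebra
    Algebra.FiniteType (RingModP p A) (RingModP p B) := by
  let _ : Algebra (RingModP p A) (RingModP p B) := (RingModP.map p A B).toAlgebra
  have : IsScalarTower A (RingModP p A) (RingModP p B) := .of_algebraMap_eq fun a => rfl
  exact Algebra.FiniteType.of_restrictScalars_finiteType A _ _

theorem FrobPullback.projective (p : ℕ) [Fact p.Prime] (B M : Type*) [CommRing B] [AddCommGroup M]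
    [Module (RingModP p B) M] [Module.Projective (RingModP p B) M] :
    Module.Projective (RingModP p B) (FrobPullback p B M) :=
  inferInstanceAs (Module.Projective (FrobTwist p B) (FrobTwist p B ⊗[RingModP p B] M))

theorem FrobPullback.finite (p : ℕ) [Fact p.Prime] (B M : Type*) [CommRing B] [AddCommGroup M]
    [Module (RingModP p B) M] [Module.Finite (RingModP p B) M] :
    Module.Finite (RingModP p B) (FrobPullback p B M) :=
  inferInstanceAs (Module.Finite (FrobTwist p B) (FrobTwist p B ⊗[RingModP p B] M))

namespace FWDiff

variable (p : ℕ) [Fact p.Prime] (A B : Type*) [CommRing A] [CommRing B] [Algebra A B]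

theorem projective_pullback [Algebra.FormallySmooth A B] :
    Module.Projective (RingModP p B) (FrobPullback p B (KaehlerModP p A B)) := by
  let _ : Algebra (RingModP p A) (RingModP p B) := (RingModP.map p A B).toAlgebra
  have := RingModP.formallySmooth_map p A B
  exact FrobPullback.projective p B Ω[RingModP p B⁄RingModP p A]

theorem finite_pullback [Algebra.FiniteType A B] :
    Module.Finite (RingModP p B) (FrobPullback p B (KaehlerModP p A B)) := by
  let _ : Algebra (RingModP p A) (RingModP p B) := (RingModP.map p A B).toAlgebra
  have := RingModP.finiteType_map p A B
  exact FrobPullback.finite p B Ω[RingModP p B⁄RingModP p A]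

/-- The isomorphism `Coker (FΩ¹_A ⊗_A B → FΩ¹_B) ≃ F^*Ω¹_{B₁/A₁}` of `B₁`-modules. -/
def cokerEquiv [Algebra (ZLoc p) B] :
    Coker p A B ≃ₗ[RingModP p B] FrobPullback p B (KaehlerModP p A B) :=
  LinearEquiv.ofBijective
    { cokerToPullback p A B with
      map_smul' := fun b x => by
        obtain ⟨b, rfl⟩ := Ideal.Quotient.mk_surjective b
        exact (cokerToPullback p A B).map_smul b x }
    (cokerToPullback_bijective p A B)

end FWDiff

/-! ### Frobenius-Witt derivations with prescribed values on the maximal ideal. -/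

/-- Over a subfield `K` of `L` with `x ^ p ∈ K` and `x ∉ K`, the powers of `x` of exponent less than
`p` are linearly independent. -/
theorem Polynomial.eq_zero_of_aeval_eq_zero_of_pow_mem {p : ℕ} (hp : p.Prime) {K L : Type*} [Field K]
    [Field L] [Algebra K L] [CharP L p] {x : L} (hx : x ∉ (algebraMap K L).range)
    (hxp : x ^ p ∈ (algebraMap K L).range) {f : Polynomial K} (hf : f.degree < p)
    (h : aeval x f = 0) : f = 0 := by
  have := Fact.mk hp
  obtain ⟨c, hc⟩ := hxp
  -- A `p`-th root of `c` in `K` would equal `x` by injectivity of Frobenius. Hence `X ^ p - c` is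
  -- the minimal polynomial of `x` up to a unit.
  have hirr : Irreducible (X ^ p - C c : Polynomial K) := by
    refine X_pow_sub_C_irreducible_of_prime hp fun b hb => hx ⟨b, ?_⟩
    refine frobenius_inj L p ?_
    rw [frobenius_def, frobenius_def, ← map_pow, hb, hc]
  by_contra hf0
  have hdvd : minpoly K x ∣ X ^ p - C c := minpoly.dvd K x (by simp [hc])
  have hassoc : Associated (minpoly K x) (X ^ p - C c) := by
    refine (hirr.dvd_iff.mp hdvd).resolve_left (minpoly.not_isUnit K x) |>.symm
  have hle := minpoly.degree_le_of_ne_zero K x hf0 h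
  rw [degree_eq_degree_of_associated hassoc, degree_X_pow_sub_C hp.pos] at hle
  exact absurd hf (not_lt.mpr hle)

section ResidueLift

open IsLocalRing

variable {p : ℕ} {R : Type*} [CommRing R] [IsLocalRing R] [CharP (ResidueField R) p]

theorem ResidueField.natCast_smul_eq_zero (m : ResidueField R) : (p : ResidueField R) • m = 0 := by
  rw [CharP.cast_eq_zero, zero_smul]

/-- The product of `R` and the extension of the residue field `k` by `k` of class `μ`. -/
abbrev ResidueExt (p : ℕ) (R : Type*) [CommRing R] [IsLocalRing R] [CharP (ResidueField R) p]
    (μ : ResidueField R) : Type _ :=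
  R × FWExt p μ (ResidueField.natCast_smul_eq_zero (p := p) (R := R))

variable (p) in
theorem natCast_mem_maximalIdeal : (p : R) ∈ maximalIdeal R := by
  rw [← residue_eq_zero_iff, map_natCast, CharP.cast_eq_zero]

variable [hp : Fact p.Prime]

/-- The partial lifts of `R → k` to the extension of `k` by `k`, given as subrings of the product,
that agree with `φ ^ p` on the maximal ideal. -/
structure IsPartialLift (p : ℕ) {R : Type*} [CommRing R] [IsLocalRing R]
    [CharP (ResidueField R) p] [Fact p.Prime] (φ : maximalIdeal R →ₗ[R] ResidueField R)
    {μ : ResidueField R} (G : Subring (ResidueExt p R μ)) : Prop where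
  mem_of_mem (m : maximalIdeal R) : (m.1, ⟨0, φ m ^ p⟩) ∈ G
  pow_mem (a : R) : (a ^ p, ⟨residue R a ^ p, 0⟩) ∈ G
  fst_eq : ∀ z ∈ G, z.2.fst = residue R z.1
  eq_zero : ∀ z ∈ G, z.1 = 0 → z = 0

variable (φ : maximalIdeal R →ₗ[R] ResidueField R)

theorem map_smul_eq_zero_of_mem {x : R} (hx : x ∈ maximalIdeal R) (y : maximalIdeal R) :
    φ (x • y) = 0 := by
  rw [map_smul, Algebra.smul_def]
  simp [(residue_eq_zero_iff x).mpr hx, ResidueField.algebraMap_eq]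

/-- The starting ring lies over the elements `a ^ p + m` with `m ∈ 𝔪`, and its second component is
`φ m ^ p`. It is closed under addition because `a ^ p + b ^ p = (a + b) ^ p - p P(a, b)`, which is
where `μ = φ(p) ^ p` is forced. -/
theorem exists_isPartialLift {μ : ResidueField R}
    (hμ : φ ⟨p, natCast_mem_maximalIdeal p⟩ ^ p = μ) :
    ∃ G : Subring (ResidueExt p R μ), IsPartialLift p φ G := by
  have hp1 := hp.out.one_lt
  -- If `a ^ p ∈ 𝔪` then `a ∈ 𝔪`, so `a ^ p ∈ 𝔪²`. This makes the value independent of the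
  -- decomposition `a ^ p + m`.
  have hpow : ∀ (a : R) (ha : a ^ p ∈ maximalIdeal R), φ ⟨a ^ p, ha⟩ = 0 := by
    intro a ha
    have ha' : a ∈ maximalIdeal R := (inferInstance : (maximalIdeal R).IsPrime).mem_of_pow_mem _ ha
    have h1 : a ^ (p - 1) ∈ maximalIdeal R := Ideal.pow_mem_of_mem _ ha' _ (by omega)
    rw [← map_smul_eq_zero_of_mem φ h1 ⟨a, ha'⟩]
    congr 1
    ext
    exact (pow_sub_one_mul hp.out.ne_zero a).symm
  have hsmul : ∀ (r : R) (m : maximalIdeal R), φ (r • m) = residue R r * φ m := by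
    intro r m
    rw [map_smul, Algebra.smul_def, ResidueField.algebraMap_eq]
  let G : Subring (ResidueExt p R μ) :=
    { carrier := {z | ∃ (a : R) (m : maximalIdeal R),
        z = (a ^ p + m.1, ⟨residue R a ^ p, φ m ^ p⟩)}
      mul_mem' := by
        rintro _ _ ⟨a, m, rfl⟩ ⟨b, n, rfl⟩
        refine ⟨a * b, (a ^ p) • n + (b ^ p) • m + m.1 • n, ?_⟩
        refine Prod.ext ?_ (FWExt.ext ?_ ?_)
        · simp only [Prod.fst_mul, Submodule.coe_add, Submodule.coe_smul, smul_eq_mul]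
          ring
        · simp only [Prod.snd_mul, FWExt.mul_fst, map_mul, mul_pow]
        · simp only [Prod.snd_mul, FWExt.mul_snd, smul_eq_mul, map_add,
            map_smul_eq_zero_of_mem φ m.2 n, add_zero, hsmul, map_pow, add_pow_char, mul_pow]
          ring
      one_mem' := ⟨1, 0, by
        refine Prod.ext ?_ (FWExt.ext ?_ ?_) <;> simp [hp.out.ne_zero]⟩
      add_mem' := by
        rintro _ _ ⟨a, m, rfl⟩ ⟨b, n, rfl⟩
        refine ⟨a + b, m + n - FW.P p a b • ⟨p, natCast_mem_maximalIdeal p⟩, ?_⟩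
        refine Prod.ext ?_ (FWExt.ext ?_ ?_)
        · have h := FW.mul_P p a b
          simp only [Prod.fst_add, Submodule.coe_sub, Submodule.coe_add, Submodule.coe_smul,
            smul_eq_mul]
          linear_combination h
        · simp only [Prod.snd_add, FWExt.add_fst, map_add, add_pow_char]
        · have h := FW.P_map p (frobenius (ResidueField R) p) (residue R a) (residue R b)
          simp only [frobenius_def] at h
          simp only [Prod.snd_add, FWExt.add_snd, map_sub, map_add, hsmul, FW.P_map,
            sub_pow_char, add_pow_char, mul_pow, hμ, ← h, smul_eq_mul]
      zero_mem' := ⟨0, 0, by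
        refine Prod.ext ?_ (FWExt.ext ?_ ?_) <;> simp [hp.out.ne_zero]⟩
      neg_mem' := by
        rintro _ ⟨a, m, rfl⟩
        -- Since `(-a) ^ p + a ^ p = -p P(-a, a)`, this choice also covers `p = 2`.
        refine ⟨-a, FW.P p (-a) a • ⟨p, natCast_mem_maximalIdeal p⟩ - m, ?_⟩
        have h0 : (-residue R a) ^ p = -residue R a ^ p :=
          map_neg (frobenius (ResidueField R) p) (residue R a)
        refine Prod.ext ?_ (FWExt.ext ?_ ?_)
        · have h := FW.mul_P p (-a) a
          rw [neg_add_cancel, zero_pow hp.out.ne_zero] at h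
          simp only [Prod.fst_neg, Submodule.coe_sub, Submodule.coe_smul, smul_eq_mul]
          linear_combination -h
        · simp only [Prod.snd_neg, FWExt.neg_fst, map_neg, h0]
        · have h := FW.P_map p (frobenius (ResidueField R) p) (-residue R a) (residue R a)
          simp only [frobenius_def, h0] at h
          simp only [Prod.snd_neg, FWExt.neg_snd, map_sub, hsmul, FW.P_map,
            sub_pow_char, mul_pow, hμ, ← h, smul_eq_mul, map_neg] }
  refine ⟨G, ?_, ?_, ?_, ?_⟩
  · exact fun m => ⟨0, m, by
      refine Prod.ext ?_ (FWExt.ext ?_ ?_) <;> simp [hp.out.ne_zero]⟩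
  · exact fun a => ⟨a, 0, by
      refine Prod.ext ?_ (FWExt.ext ?_ ?_) <;> simp [hp.out.ne_zero]⟩
  · rintro _ ⟨a, m, rfl⟩
    simp [(residue_eq_zero_iff m.1).mpr m.2]
  · rintro _ ⟨a, m, rfl⟩ h
    have h' : a ^ p + m.1 = 0 := h
    have ha : a ^ p ∈ maximalIdeal R := by
      rw [eq_neg_of_add_eq_zero_left h']
      exact neg_mem m.2
    have hm : m = -⟨a ^ p, ha⟩ := by
      ext
      exact eq_neg_of_add_eq_zero_right h'
    refine Prod.ext h (FWExt.ext ?_ ?_)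
    · rw [← map_pow]
      exact (residue_eq_zero_iff _).mpr ha
    · simp only [hm, map_neg, hpow, neg_zero]
      simp [hp.out.ne_zero]

section Adjoin

variable {φ} {μ : ResidueField R} {G : Subring (ResidueExt p R μ)}

variable (p μ) in
/-- The composite of the projection to `R` and the residue map. -/
def ResidueExt.residue : ResidueExt p R μ →+* ResidueField R :=
  (IsLocalRing.residue R).comp (RingHom.fst _ _)

/-- The subfield of the residue field formed by the residues of a partial lift. -/
def IsPartialLift.residueSubfield (hG : IsPartialLift p φ G) : Subfield (ResidueField R) :=
  { G.map (ResidueExt.residue p μ) with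
    inv_mem' := by
      rintro _ ⟨z, hz, rfl⟩
      by_cases h0 : ResidueExt.residue p μ z = 0
      · exact ⟨0, G.zero_mem, by rw [h0, inv_zero, map_zero]⟩
      obtain ⟨a, ha⟩ := residue_surjective (ResidueExt.residue p μ z)⁻¹
      -- The inverse is `z⁻¹ = (z⁻¹) ^ p * z ^ (p - 1)`, and lifts of `p`-th powers always lie in
      -- `G`.
      refine ⟨(a ^ p, ⟨IsLocalRing.residue R a ^ p, 0⟩) * z ^ (p - 1),
        G.mul_mem (hG.pow_mem a) (G.pow_mem hz _), ?_⟩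
      have h1 : ResidueExt.residue p μ (a ^ p, ⟨IsLocalRing.residue R a ^ p, 0⟩)
          = (ResidueExt.residue p μ z)⁻¹ ^ p := by
        rw [← ha]
        exact map_pow (IsLocalRing.residue R) a p
      rw [map_mul, h1, map_pow, ← pow_sub_one_mul hp.out.ne_zero, mul_right_comm, ← mul_pow,
        inv_mul_cancel₀ h0, one_pow, one_mul] }

/-- The residue map of a partial lift. -/
def IsPartialLift.toResidueSubfield (hG : IsPartialLift p φ G) : G →+* hG.residueSubfield :=
  ((ResidueExt.residue p μ).comp G.subtype).codRestrict hG.residueSubfield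
    fun z => ⟨z.1, z.2, rfl⟩

/-- `G` lies over all of `𝔪`, so whether `x` is reached depends only on its residue. -/
theorem IsPartialLift.mem_of_residue_eq (hG : IsPartialLift p φ G) {x : R} {z : ResidueExt p R μ}
    (hz : z ∈ G) (h : IsLocalRing.residue R x = IsLocalRing.residue R z.1) :
    ∃ z' ∈ G, z'.1 = x := by
  have hm : x - z.1 ∈ maximalIdeal R := by rw [← residue_eq_zero_iff, map_sub, h, sub_self]
  exact ⟨_, G.add_mem (hG.mem_of_mem ⟨_, hm⟩) hz, sub_add_cancel x z.1⟩

theorem IsPartialLift.snd_eq (hG : IsPartialLift p φ G) {z : ResidueExt p R μ} (hz : z ∈ G)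
    (hm : z.1 ∈ maximalIdeal R) : z.2 = ⟨0, φ ⟨z.1, hm⟩ ^ p⟩ := by
  have h := hG.eq_zero _ (G.sub_mem hz (hG.mem_of_mem ⟨z.1, hm⟩)) (sub_self z.1)
  rw [sub_eq_zero] at h
  exact congrArg Prod.snd h

theorem FWExt.mk_zero_pow_add (x y : maximalIdeal R) :
    (⟨0, φ (x + y) ^ p⟩ : FWExt p μ (ResidueField.natCast_smul_eq_zero (p := p) (R := R)))
      = ⟨0, φ x ^ p⟩ + ⟨0, φ y ^ p⟩ := by
  refine FWExt.ext ?_ ?_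
  · simp
  · simp [FWExt.add_snd, FW.P_zero_left, add_pow_char]

theorem FWExt.sum_mk_zero_pow {ι : Type*} (s : Finset ι) (f : ι → maximalIdeal R) :
    ∑ i ∈ s, (⟨0, φ (f i) ^ p⟩ : FWExt p μ (ResidueField.natCast_smul_eq_zero (p := p) (R := R)))
      = ⟨0, φ (∑ i ∈ s, f i) ^ p⟩ := by
  classical
  induction s using Finset.induction_on with
  | empty => refine FWExt.ext ?_ ?_ <;> simp [hp.out.ne_zero]
  | insert i s hi ih => rw [Finset.sum_insert hi, Finset.sum_insert hi, ih, FWExt.mk_zero_pow_add]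

/-- Give `x` the value `0`. Its lift `y` has `y ^ p ∈ G`, so every new element is `∑ gᵢ yⁱ` with `i
< p`. If this lies over `0`, independence of the powers of the residue of `x` puts every `gᵢ` over
`𝔪`; the second component is then `φ(∑ gᵢ xⁱ) ^ p = 0`, so the extended ring is still a graph. -/
theorem IsPartialLift.exists_adjoin (hG : IsPartialLift p φ G) {x : R} (hx : ∀ z ∈ G, z.1 ≠ x) :
    ∃ G' : Subring (ResidueExt p R μ), IsPartialLift p φ G' ∧ G ≤ G' ∧ ∃ z ∈ G', z.1 = x := by
  open Polynomial in
  set y : ResidueExt p R μ := (x, ⟨IsLocalRing.residue R x, 0⟩) with hy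
  have hyp : y ^ p ∈ G := by
    have h := hG.pow_mem x
    rwa [← FWExt.mk_zero_pow] at h
  let E : G[X] →+* ResidueExt p R μ := eval₂RingHom G.subtype y
  have hEC : ∀ g : G, E (C g) = g := fun g => by simp [E]
  have hEX : E X = y := by simp [E]
  let F : G[X] := X ^ p - C ⟨y ^ p, hyp⟩
  have hF : F.Monic := monic_X_pow_sub_C _ hp.out.ne_zero
  have hEF : E F = 0 := by
    rw [map_sub, map_pow, hEC, hEX, sub_self]
  have hred : ∀ f : G[X], ∃ g : G[X], g.degree < p ∧ E g = E f := by
    intro f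
    refine ⟨f %ₘ F, ?_, ?_⟩
    · have h := degree_modByMonic_lt f hF
      rwa [degree_X_pow_sub_C hp.out.pos] at h
    · conv_rhs => rw [← modByMonic_add_div f F]
      rw [map_add, map_mul, hEF, zero_mul, add_zero]
  refine ⟨E.range, ⟨?_, ?_, ?_, ?_⟩, ?_, y, ⟨X, hEX⟩, rfl⟩
  · exact fun m => ⟨C ⟨_, hG.mem_of_mem m⟩, hEC _⟩
  · exact fun a => ⟨C ⟨_, hG.pow_mem a⟩, hEC _⟩
  · rintro _ ⟨f, rfl⟩
    have h : (FWExt.fstHom.comp (RingHom.snd _ _)).comp E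
        = (ResidueExt.residue p μ).comp E := by
      refine Polynomial.ringHom_ext (fun g => ?_) ?_
      · change (E (C g)).2.fst = IsLocalRing.residue R (E (C g)).1
        rw [hEC]
        exact hG.fst_eq g g.2
      · change (E X).2.fst = IsLocalRing.residue R (E X).1
        rw [hEX]
    exact DFunLike.congr_fun h f
  · rintro _ ⟨f, rfl⟩ h0
    obtain ⟨g, hg, hgf⟩ := hred f
    rw [← hgf] at h0 ⊢
    have hE : E g = ∑ i ∈ Finset.range p, (g.coeff i : ResidueExt p R μ) * y ^ i := by
      by_cases hg0 : g = 0
      · simp [hg0]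
      · exact eval₂_eq_sum_range' _ ((natDegree_lt_iff_degree_lt hg0).mpr hg) y
    -- The residue of `x` lies outside the residue subfield of `G`, but its `p`-th power lies
    -- inside, so a relation of degree less than `p` is trivial.
    have hcoeff : ∀ i, (g.coeff i : ResidueExt p R μ).1 ∈ maximalIdeal R := by
      have hmap : g.map hG.toResidueSubfield = 0 := by
        refine Polynomial.eq_zero_of_aeval_eq_zero_of_pow_mem (L := ResidueField R)
          (x := IsLocalRing.residue R x) hp.out ?_ ?_ (degree_map_le.trans_lt hg) ?_
        · rintro ⟨⟨_, z, hz, rfl⟩, h⟩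
          obtain ⟨z', hz', h'⟩ := hG.mem_of_residue_eq hz h.symm
          exact hx z' hz' h'
        · exact ⟨⟨_, y ^ p, hyp, rfl⟩, map_pow (IsLocalRing.residue R) x p⟩
        · have h1 : (ResidueExt.residue p μ) (E g) = 0 := by
            rw [ResidueExt.residue, RingHom.comp_apply, RingHom.coe_fst, h0, map_zero]
          rw [← h1, aeval_def, eval₂_map, ← coe_eval₂RingHom, ← RingHom.comp_apply]
          refine DFunLike.congr_fun (f := eval₂RingHom _ _) (g := (ResidueExt.residue p μ).comp E)
            (Polynomial.ringHom_ext (fun a => ?_) ?_) g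
          · rw [RingHom.comp_apply, hEC, coe_eval₂RingHom, eval₂_C]
            rfl
          · rw [RingHom.comp_apply, hEX, coe_eval₂RingHom, eval₂_X]
            rfl
      intro i
      have h2 := congrArg (fun f => ((f.coeff i : hG.residueSubfield) : ResidueField R)) hmap
      simp only [coeff_map, coeff_zero] at h2
      exact (residue_eq_zero_iff _).mp h2
    refine Prod.ext h0 ?_
    have h3 : (E g).2 = ∑ i ∈ Finset.range p, (⟨0, φ (x ^ i • ⟨_, hcoeff i⟩) ^ p⟩ :
        FWExt p μ (ResidueField.natCast_smul_eq_zero (p := p) (R := R))) := by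
      rw [hE, Prod.snd_sum]
      refine Finset.sum_congr rfl fun i _ => ?_
      rw [Prod.snd_mul, hG.snd_eq (g.coeff i).2 (hcoeff i), Prod.pow_snd, hy, FWExt.mk_zero_pow]
      refine FWExt.ext ?_ ?_
      · simp
      · rw [map_smul, Algebra.smul_def (R := R), ResidueField.algebraMap_eq, mul_pow, map_pow]
        simp [FWExt.mul_snd]
    have h4 : ∑ i ∈ Finset.range p, x ^ i • (⟨_, hcoeff i⟩ : maximalIdeal R) = 0 := by
      ext
      rw [hE, Prod.fst_sum] at h0
      rw [Submodule.coe_sum, Submodule.coe_zero, ← h0]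
      refine Finset.sum_congr rfl fun i _ => ?_
      rw [Prod.fst_mul, Prod.pow_fst, Submodule.coe_smul, smul_eq_mul, mul_comm]
    rw [h3, FWExt.sum_mk_zero_pow, h4, map_zero, zero_pow hp.out.ne_zero]
    rfl
  · exact fun g hg => ⟨C ⟨g, hg⟩, hEC _⟩

theorem isPartialLift_sSup {c : Set (Subring (ResidueExt p R μ))}
    (hc : IsChain (· ≤ ·) c) (hne : c.Nonempty) (h : ∀ G ∈ c, IsPartialLift p φ G) :
    IsPartialLift p φ (sSup c) := by
  have hmem : ∀ z, z ∈ sSup c ↔ ∃ G ∈ c, z ∈ G := fun z =>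
    Subring.mem_sSup_of_directedOn hne hc.directedOn
  obtain ⟨G, hG⟩ := hne
  refine ⟨fun m => ?_, fun a => ?_, fun z hz => ?_, fun z hz => ?_⟩
  · exact (hmem _).mpr ⟨G, hG, (h G hG).mem_of_mem m⟩
  · exact (hmem _).mpr ⟨G, hG, (h G hG).pow_mem a⟩
  · obtain ⟨G', hG', hz⟩ := (hmem z).mp hz
    exact (h G' hG').fst_eq z hz
  · obtain ⟨G', hG', hz⟩ := (hmem z).mp hz
    exact (h G' hG').eq_zero z hz

end Adjoin

/-- The `p`-th power of a linear form on the cotangent space of a local ring of residue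
characteristic `p` extends to a Frobenius-Witt derivation. -/
theorem exists_isFWDerivation_eq_pow :
    ∃ w : R → ResidueField R, IsFWDerivation p w ∧ ∀ m : maximalIdeal R, w m = φ m ^ p := by
  set μ := φ ⟨p, natCast_mem_maximalIdeal p⟩ ^ p with hμ
  obtain ⟨G₀, hG₀⟩ := exists_isPartialLift φ hμ.symm
  obtain ⟨G, hG⟩ := zorn_le₀ {G : Subring (ResidueExt p R μ) | IsPartialLift p φ G} fun c hc hchain => by
    rcases c.eq_empty_or_nonempty with rfl | hne
    · exact ⟨G₀, hG₀, by simp⟩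
    · exact ⟨_, isPartialLift_sSup hchain hne hc, fun _ => le_sSup⟩
  have hG1 : IsPartialLift p φ G := hG.1
  have hsurj : ∀ x : R, ∃ z ∈ G, z.1 = x := by
    intro x
    by_contra! hx
    obtain ⟨G', hG', hle, z, hz, hzx⟩ := hG1.exists_adjoin hx
    exact hx z (hG.2 hG' hle hz) hzx
  -- By maximality `G` is the graph of a ring morphism on all of `R`.
  let e : G ≃+* R := RingEquiv.ofBijective ((RingHom.fst _ _).comp G.subtype)
    ⟨(injective_iff_map_eq_zero _).mpr fun z hz => Subtype.ext (hG1.eq_zero z z.2 hz),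
      fun x => by
        obtain ⟨z, hz, h⟩ := hsurj x
        exact ⟨⟨z, hz⟩, h⟩⟩
  have he : ∀ a, (e.symm a : ResidueExt p R μ).1 = a := e.apply_symm_apply
  let f : R →+* FWExt p μ (ResidueField.natCast_smul_eq_zero (p := p) (R := R)) :=
    ((RingHom.snd _ _).comp G.subtype).comp e.symm.toRingHom
  have hf : ∀ m : maximalIdeal R, (f m).snd = φ m ^ p := by
    intro m
    have h := hG1.snd_eq (e.symm m.1).2 (by rw [he]; exact m.2)
    have h' : f m = ⟨0, φ ⟨_, _⟩ ^ p⟩ := h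
    rw [h']
    simp only [he]
  refine ⟨fun a => (f a).snd, FWExt.isFWDerivation_snd f (fun a => ?_) ?_, hf⟩
  · refine (hG1.fst_eq _ (e.symm a).2).trans ?_
    rw [he]
    rfl
  · exact hf ⟨p, natCast_mem_maximalIdeal p⟩

end ResidueLift

/-! ### Quotients of regular local rings. -/

namespace IsRegularLocalRing

open IsLocalRing

/-- The class of `x` extends to a basis of `𝔪/𝔪²`, which lifts to minimal generators including `x`;
modulo `x` the others generate. -/
theorem spanFinrank_maximalIdeal_quotient_lt {R : Type*} [CommRing R] [IsLocalRing R]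
    [IsNoetherianRing R] {x : R} (hx : x ∈ maximalIdeal R) (hx2 : x ∉ maximalIdeal R ^ 2)
    [IsLocalRing (R ⧸ Ideal.span {x})] :
    (maximalIdeal (R ⧸ Ideal.span {x})).spanFinrank < (maximalIdeal R).spanFinrank := by
  classical
  set v : CotangentSpace R := (maximalIdeal R).toCotangent ⟨x, hx⟩ with hv
  have hv0 : v ≠ 0 := fun h => hx2 (((maximalIdeal R).toCotangent_eq_zero _).mp h)
  obtain ⟨b, -, hvb, hspan, hli⟩ := exists_linearIndepOn_id_extension
    (LinearIndepOn.singleton (R := ResidueField R) (v := id) hv0) (Set.subset_univ {v})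
  rw [Set.singleton_subset_iff] at hvb
  have hspan' : Submodule.span (ResidueField R) b = ⊤ := by
    rw [eq_top_iff]
    exact fun z _ => hspan (Set.mem_univ z)
  have hfin : b.Finite := hli.setFinite
  have hcard : b.ncard = (maximalIdeal R).spanFinrank := by
    have := hfin.fintype
    rw [spanFinrank_maximalIdeal_eq_finrank_cotangentSpace, Set.ncard_eq_toFinset_card',
      ← finrank_span_set_eq_card hli, hspan', finrank_top]
  choose l hl using (maximalIdeal R).toCotangent_surjective
  -- The lift is modified so that the class `v` lifts to `x` itself.
  let l' : CotangentSpace R → maximalIdeal R := Function.update l v ⟨x, hx⟩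
  have hl' : ∀ u, (maximalIdeal R).toCotangent (l' u) = u := by
    intro u
    by_cases hu : u = v
    · rw [hu]
      simp [l', hv]
    · simp [l', hu, hl]
  have hs : Submodule.span R (l' '' b) = ⊤ := by
    rw [← CotangentSpace.span_image_eq_top_iff, ← Set.image_comp]
    have : (maximalIdeal R).toCotangent ∘ l' = id := funext hl'
    rw [this, Set.image_id, hspan']
  have hs' : Ideal.span ((fun u => (l' u : R)) '' b) = maximalIdeal R := by
    have h := congrArg (Submodule.map (maximalIdeal R).subtype) hs
    rwa [Submodule.map_span, Submodule.map_subtype_top, ← Set.image_comp] at h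
  let mk := Ideal.Quotient.mk (Ideal.span {x})
  have hmax : maximalIdeal (R ⧸ Ideal.span {x})
      = Ideal.span ((fun u => mk (l' u)) '' (b \ {v})) := by
    have h := congrArg (Ideal.map mk) hs'
    rw [Ideal.map_span, ← Set.image_comp] at h
    rw [← map_maximalIdeal_of_surjective mk Ideal.Quotient.mk_surjective, ← h]
    refine le_antisymm ?_ (Ideal.span_mono (Set.image_mono Set.sdiff_subset))
    rw [Ideal.span_le]
    rintro _ ⟨u, hu, rfl⟩
    by_cases huv : u = v
    · have h0 : (mk ∘ fun u => (l' u : R)) u = 0 := by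
        rw [huv]
        simp [l', mk]
      rw [h0]
      exact zero_mem _
    · exact Ideal.subset_span ⟨u, ⟨hu, huv⟩, rfl⟩
  rw [hmax, ← hcard]
  refine (Submodule.spanFinrank_span_le_ncard_of_finite (hfin.sdiff.image _)).trans_lt ?_
  refine (Set.ncard_image_le hfin.sdiff).trans_lt ?_
  exact Set.ncard_sdiff_singleton_lt_of_mem hvb hfin

theorem exists_natCast_eq_ringKrullDim (R : Type*) [CommRing R] [IsLocalRing R]
    [IsNoetherianRing R] : ∃ n : ℕ, ringKrullDim R = n := by
  have h1 := ringKrullDim_le_spanFinrank_maximalIdeal R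
  have h2 : ringKrullDim R ≠ ⊥ := ringKrullDim_ne_bot
  obtain ⟨d, hd⟩ := WithBot.ne_bot_iff_exists.mp h2
  rw [← hd] at h1 ⊢
  have h3 : d ≤ ((maximalIdeal R).spanFinrank : ℕ∞) := by exact_mod_cast h1
  obtain ⟨n, rfl⟩ := ENat.ne_top_iff_exists.mp (ne_top_of_le_ne_top (ENat.natCast_ne_top _) h3)
  exact ⟨n, rfl⟩

/-- The dimension drops by at most one and the embedding dimension by at least one; as dimension
never exceeds embedding dimension, all inequalities are equalities. -/
theorem quotient_span_singleton {R : Type*} [CommRing R] [IsRegularLocalRing R] {x : R}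
    (hx : x ∈ maximalIdeal R) (hx2 : x ∉ maximalIdeal R ^ 2) :
    ∃ _ : IsRegularLocalRing (R ⧸ Ideal.span {x}),
      (maximalIdeal (R ⧸ Ideal.span {x})).spanFinrank + 1 = (maximalIdeal R).spanFinrank := by
  have hne : Ideal.span {x} ≠ ⊤ := fun h =>
    (maximalIdeal.isMaximal R).ne_top (top_le_iff.mp (h ▸ (Ideal.span_singleton_le_iff_mem _).mpr hx))
  have : Nontrivial (R ⧸ Ideal.span {x}) := Ideal.Quotient.nontrivial_iff.mpr hne
  have : IsLocalRing (R ⧸ Ideal.span {x}) :=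
    .of_surjective' (Ideal.Quotient.mk _) Ideal.Quotient.mk_surjective
  have h1 := spanFinrank_maximalIdeal_quotient_lt hx hx2
  have h2 : ringKrullDim R ≤ ringKrullDim (R ⧸ Ideal.span {x}) + 1 := by
    refine (ringKrullDim_le_ringKrullDim_quotient_add_spanFinrank _
      ((le_maximalIdeal hne).trans_eq (ringJacobson_eq_maximalIdeal R).symm)).trans ?_
    gcongr
    have := Submodule.spanFinrank_span_le_ncard_of_finite (R := R) (Set.finite_singleton x)
    rw [Set.ncard_singleton] at this
    exact_mod_cast this
  rw [← (isRegularLocalRing_iff R).mp ‹_›] at h2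
  obtain ⟨k, hk⟩ := exists_natCast_eq_ringKrullDim (R ⧸ Ideal.span {x})
  have h3 := ringKrullDim_le_spanFinrank_maximalIdeal (R ⧸ Ideal.span {x})
  rw [hk] at h2 h3
  have h2' : (maximalIdeal R).spanFinrank ≤ k + 1 := by exact_mod_cast h2
  have h3' : k ≤ (maximalIdeal (R ⧸ Ideal.span {x})).spanFinrank := by exact_mod_cast h3
  refine ⟨of_spanFinrank_maximalIdeal_le _ ?_, by omega⟩
  rw [hk]
  exact_mod_cast (by omega)

/-- Induction on the embedding dimension. Choose `x ∈ 𝔪` outside `𝔪²` and the minimal primes. Then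
`(x)` is prime and contains a minimal prime `P`; as `x ∉ P`, `P = xP`, so `P = 0` by Nakayama. -/
theorem isDomain (R : Type*) [CommRing R] [IsRegularLocalRing R] : IsDomain R := by
  obtain ⟨n, hn⟩ : ∃ n, (maximalIdeal R).spanFinrank = n := ⟨_, rfl⟩
  induction n using Nat.strong_induction_on generalizing R with
  | h n ih =>
    have hfg := (maximalIdeal R).fg_of_isNoetherianRing
    by_cases hbot : maximalIdeal R = ⊥
    · exact (isField_iff_maximalIdeal_eq.mpr hbot).isDomain
    have hmin : (minimalPrimes R).Finite := minimalPrimes.finite_of_isNoetherianRing R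
    obtain ⟨x, hx, hxs⟩ : ∃ x ∈ maximalIdeal R, x ∉ maximalIdeal R ^ 2 ∧
        ∀ P ∈ minimalPrimes R, x ∉ P := by
      by_contra! hcon
      have hsub : (maximalIdeal R : Set R) ⊆
          ⋃ i ∈ (↑(insert (maximalIdeal R ^ 2) hmin.toFinset) : Set (Ideal R)), ((id i : Ideal R) : Set R) := by
        intro x hx
        by_cases hx2 : x ∈ maximalIdeal R ^ 2
        · exact Set.mem_biUnion (by simp) hx2
        · obtain ⟨P, hP, hxP⟩ := hcon x hx hx2
          exact Set.mem_biUnion (by simp [hP]) hxP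
      -- Prime avoidance exempts two ideals from being prime; only `𝔪²` needs it, so it fills both
      -- places.
      rw [Ideal.subset_union_prime (maximalIdeal R ^ 2) (maximalIdeal R ^ 2)] at hsub
      · obtain ⟨P, hP, hle⟩ := hsub
        rw [Finset.mem_insert, Set.Finite.mem_toFinset] at hP
        rcases hP with rfl | hP
        · refine hbot (Submodule.eq_bot_of_le_smul_of_le_jacobson_bot (maximalIdeal R) _ hfg ?_
            (jacobson_eq_maximalIdeal _ bot_ne_top).ge)
          rwa [smul_eq_mul, ← pow_two]
        · have hP1 : P.IsPrime := hP.1.1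
          have hPm : P = maximalIdeal R := le_antisymm (le_maximalIdeal hP1.ne_top) hle
          have h0 : (maximalIdeal R).height = 0 := by
            rw [← hPm, Ideal.height_eq_zero_iff]
            exact hP
          have h1 := maximalIdeal_height_eq_ringKrullDim (R := R)
          rw [h0, ← (isRegularLocalRing_iff R).mp ‹_›] at h1
          have h2 : (maximalIdeal R).spanFinrank = 0 := by exact_mod_cast h1.symm
          exact hbot ((Submodule.spanFinrank_eq_zero_iff_eq_bot hfg).mp h2)
      · intro P hP hne _
        rw [Finset.mem_insert, Set.Finite.mem_toFinset] at hP
        exact (hP.resolve_left hne).1.1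
    obtain ⟨hreg, hrank⟩ := quotient_span_singleton hx hxs.1
    have hdom := ih _ (by omega) (R ⧸ Ideal.span {x}) rfl
    have hprime : (Ideal.span {x}).IsPrime := (Ideal.Quotient.isDomain_iff_prime _).mp hdom
    obtain ⟨P, hP, hle⟩ := Ideal.exists_minimalPrimes_le (bot_le : ⊥ ≤ Ideal.span {x})
    have hP1 : P.IsPrime := hP.1.1
    have hP0 : P = ⊥ := by
      refine Submodule.eq_bot_of_le_smul_of_le_jacobson_bot (maximalIdeal R) _
        P.fg_of_isNoetherianRing (fun y hy => ?_) (jacobson_eq_maximalIdeal _ bot_ne_top).ge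
      obtain ⟨a, rfl⟩ := Ideal.mem_span_singleton'.mp (hle hy)
      have ha := (hP1.mem_or_mem hy).resolve_right (hxs.2 P hP)
      rw [mul_comm]
      exact Ideal.mul_mem_mul hx ha
    rw [hP0] at hP1
    exact IsDomain.of_bot_isPrime R

/-- By Nakayama, dividing by `I ≤ 𝔪²` does not lower the embedding dimension, whereas in a domain
dividing by a nonzero ideal lowers the dimension. -/
theorem eq_bot_of_le_sq {R : Type*} [CommRing R] [IsRegularLocalRing R] {I : Ideal R}
    [IsRegularLocalRing (R ⧸ I)] (hI : I ≤ maximalIdeal R ^ 2) : I = ⊥ := by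
  have hfg := (maximalIdeal (R ⧸ I)).fg_of_isNoetherianRing
  have hle : (maximalIdeal R).spanFinrank ≤ (maximalIdeal (R ⧸ I)).spanFinrank := by
    classical
    obtain ⟨s, hcard, hs⟩ := Submodule.FG.exists_span_finset_card_eq_spanFinrank hfg
    choose l hl using Ideal.Quotient.mk_surjective (I := I)
    have hmk : Ideal.map (Ideal.Quotient.mk I) (Ideal.span (l '' s)) = maximalIdeal (R ⧸ I) := by
      rw [Ideal.map_span, ← Set.image_comp]
      have : Ideal.Quotient.mk I ∘ l = id := funext hl
      rw [this, Set.image_id]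
      exact hs
    have hcomap := congrArg (Ideal.comap (Ideal.Quotient.mk I)) hmk
    rw [Ideal.comap_map_of_surjective _ Ideal.Quotient.mk_surjective, ← RingHom.ker_eq_comap_bot,
      Ideal.mk_ker] at hcomap
    have hcm : Ideal.comap (Ideal.Quotient.mk I) (maximalIdeal (R ⧸ I)) = maximalIdeal R :=
      eq_maximalIdeal (Ideal.comap_isMaximal_of_surjective _ Ideal.Quotient.mk_surjective)
    rw [hcm] at hcomap
    have hgen : maximalIdeal R ≤ Ideal.span (l '' s) := by
      refine Submodule.le_of_le_smul_of_le_jacobson_bot (I := maximalIdeal R)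
        (maximalIdeal R).fg_of_isNoetherianRing
        (jacobson_eq_maximalIdeal _ bot_ne_top).ge ?_
      rw [smul_eq_mul, ← pow_two]
      conv_lhs => rw [← hcomap]
      exact sup_le_sup_left hI _
    have hgen' : Ideal.span (l '' s) = maximalIdeal R :=
      le_antisymm (by rw [← hcomap]; exact le_sup_left) hgen
    rw [← hgen', ← hcard]
    refine (Submodule.spanFinrank_span_le_ncard_of_finite (s.finite_toSet.image l)).trans ?_
    refine (Set.ncard_image_le s.finite_toSet).trans ?_
    rw [Set.ncard_coe_finset]
  have := isDomain R
  rw [Submodule.eq_bot_iff]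
  by_contra! hcon
  obtain ⟨r, hr, hr0⟩ := hcon
  have h1 : ringKrullDim (R ⧸ I) + 1 ≤ ringKrullDim R :=
    ringKrullDim_succ_le_of_surjective (Ideal.Quotient.mk I) Ideal.Quotient.mk_surjective
      (mem_nonZeroDivisors_of_ne_zero hr0) (Ideal.Quotient.eq_zero_iff_mem.mpr hr)
  rw [← (isRegularLocalRing_iff R).mp ‹_›, ← (isRegularLocalRing_iff (R ⧸ I)).mp ‹_›] at h1
  have h2 : (maximalIdeal (R ⧸ I)).spanFinrank + 1 ≤ (maximalIdeal R).spanFinrank := by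
    exact_mod_cast h1
  omega

/-- If `R` and `R/I` are regular local rings, then `I/𝔪I` injects into `𝔪/𝔪²`. -/
theorem mem_mul_of_mem_sq {R : Type*} [CommRing R] [IsRegularLocalRing R] {I : Ideal R}
    [IsRegularLocalRing (R ⧸ I)] {y : R} (hy : y ∈ I) (hy2 : y ∈ maximalIdeal R ^ 2) :
    y ∈ maximalIdeal R * I := by
  obtain ⟨n, hn⟩ : ∃ n, (maximalIdeal R).spanFinrank = n := ⟨_, rfl⟩
  induction n using Nat.strong_induction_on generalizing R with
  | h n ih =>
    by_cases hI : I ≤ maximalIdeal R ^ 2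
    · have h0 := eq_bot_of_le_sq hI
      rw [h0, Ideal.mem_bot] at hy
      rw [hy]
      exact zero_mem _
    -- Dividing by such an `x` preserves regularity and lowers the embedding dimension, so the
    -- induction hypothesis applies.
    obtain ⟨x, hxI, hx2⟩ := SetLike.not_le_iff_exists.mp hI
    have hIm : I ≤ maximalIdeal R :=
      le_maximalIdeal (Ideal.Quotient.nontrivial_iff.mp inferInstance)
    obtain ⟨hreg, hrank⟩ := quotient_span_singleton (hIm hxI) hx2
    have hle : Ideal.span {x} ≤ I := (Ideal.span_singleton_le_iff_mem _).mpr hxI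
    have : IsRegularLocalRing ((R ⧸ Ideal.span {x}) ⧸ I.map (Ideal.Quotient.mk (Ideal.span {x}))) :=
      of_ringEquiv (DoubleQuot.quotQuotEquivQuotOfLE hle).symm
    have hmap := map_maximalIdeal_of_surjective (Ideal.Quotient.mk (Ideal.span {x}))
      Ideal.Quotient.mk_surjective
    have h := ih _ (by omega) (R := R ⧸ Ideal.span {x})
      (Ideal.mem_map_of_mem (Ideal.Quotient.mk (Ideal.span {x})) hy)
      (by
        rw [← hmap, ← Ideal.map_pow]
        exact Ideal.mem_map_of_mem _ hy2) rfl
    rw [← hmap, ← Ideal.map_mul, Ideal.mem_map_iff_of_surjective _ Ideal.Quotient.mk_surjective] at h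
    obtain ⟨z, hz, hzy⟩ := h
    obtain ⟨a, ha⟩ := Ideal.mem_span_singleton'.mp (Ideal.Quotient.eq.mp hzy.symm)
    have hax : a * x ∈ maximalIdeal R ^ 2 := by
      rw [ha, pow_two]
      exact sub_mem (by rwa [← pow_two]) (Ideal.mul_mono_right hIm hz)
    -- Here `a * x = y - z ∈ 𝔪²`, so a unit `a` would put `x` in `𝔪²`.
    have ham : a ∈ maximalIdeal R := by
      by_contra hu
      rw [mem_maximalIdeal, mem_nonunits_iff, not_not] at hu
      exact hx2 ((Ideal.unit_mul_mem_iff_mem _ hu).mp hax)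
    rw [← sub_add_cancel y z, ← ha]
    exact add_mem (Ideal.mul_mem_mul ham hxI) hz

end IsRegularLocalRing

/-! ### Regularity of localized polynomial rings. -/

open IsLocalRing in
-- Localizing the base first, the ring is a localization of `R_q[X]` at a prime over the maximal
-- ideal of `R_q`, which reduces to a local base.
theorem Polynomial.isRegularLocalRing_localization_atPrime {R : Type*} [CommRing R]
    (p : Ideal (Polynomial R)) [p.IsPrime]
    [hreg : IsRegularLocalRing (Localization.AtPrime (p.comap Polynomial.C))] :
    IsRegularLocalRing (Localization.AtPrime p) := by
  let q := p.comap C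
  let S := Polynomial (Localization.AtPrime q)
  let pc := Submonoid.map Polynomial.C.toMonoidHom q.primeCompl
  let : Algebra (Polynomial R) S := algebra R (Localization.AtPrime q)
  have : IsLocalization pc S := Polynomial.isLocalization _ _
  let pS := p.map (algebraMap (Polynomial R) S)
  have disj : Disjoint (pc : Set (Polynomial R)) (p : Set (Polynomial R)) := by
    simpa [pc, q] using! Set.disjoint_image_left.mpr
      (Set.disjoint_compl_left_iff_subset.mpr (fun _ a ↦ a))
  have : pS.IsPrime := IsLocalization.isPrime_of_isPrime_disjoint pc _ _ ‹_› disj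
  have : IsLocalization.AtPrime (Localization.AtPrime pS) p := by
    convert IsLocalization.isLocalization_isLocalization_atPrime_isLocalization pc
      (Localization.AtPrime pS) pS
    exact (IsLocalization.under_map_of_isPrime_disjoint pc _ ‹_› disj).symm
  have eq : Ideal.comap C pS = maximalIdeal (Localization.AtPrime q) := by
    rw [← IsLocalization.map_under q.primeCompl _ (Ideal.comap C pS),
      ← IsLocalization.map_under q.primeCompl _ (maximalIdeal (Localization.AtPrime q))]
    simp only [Ideal.comap_comap, S, pS]
    rw [← Polynomial.algebraMap_eq (R := Localization.AtPrime q),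
      ← IsScalarTower.algebraMap_eq R (Localization.AtPrime q) (Polynomial (Localization.AtPrime q)),
      IsScalarTower.algebraMap_eq R (Polynomial R) (Polynomial (Localization.AtPrime q)),
      ← Ideal.comap_comap,
      ← Ideal.under_def (Polynomial R), IsLocalization.under_map_of_isPrime_disjoint pc _ ‹_› disj]
    simp [q, IsLocalization.AtPrime.under_maximalIdeal (Localization.AtPrime q) q]
  have := isRegularLocalRing_localization_atPrime_of_comap_eq_maximalIdeal _ pS eq
  exact IsRegularLocalRing.of_ringEquiv (R := Localization.AtPrime pS) (IsLocalization.algEquiv p.primeCompl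
    (Localization.AtPrime pS) (Localization.AtPrime p)).toRingEquiv

theorem IsRegularLocalRing.localization_atPrime_of_ringEquiv {R S : Type*} [CommRing R]
    [CommRing S] (e : R ≃+* S) (P : Ideal S) [P.IsPrime]
    [IsRegularLocalRing (Localization.AtPrime (P.comap e))] :
    IsRegularLocalRing (Localization.AtPrime P) :=
  .of_ringEquiv <| IsLocalization.ringEquivOfRingEquiv
    (Localization.AtPrime (P.comap e)) (Localization.AtPrime P) e (e.map_primeCompl_comap_eq P)

theorem MvPolynomial.isRegularLocalRing_localization_atPrime {R : Type*} [CommRing R] {n : ℕ}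
    (Q : Ideal (MvPolynomial (Fin n) R)) [Q.IsPrime] (P : Ideal R) [P.IsPrime]
    [IsRegularLocalRing (Localization.AtPrime P)] (hQ : Q.comap MvPolynomial.C = P) :
    IsRegularLocalRing (Localization.AtPrime Q) := by
  induction n with
  | zero =>
    let e := (MvPolynomial.isEmptyRingEquiv R (Fin 0)).symm
    have : Q.comap e = P := hQ
    subst this
    exact .localization_atPrime_of_ringEquiv e Q
  | succ n ih =>
    let e := (MvPolynomial.finSuccEquiv R n).symm.toRingEquiv
    let Q' := Q.comap e
    have hQ' : (Q'.comap Polynomial.C).comap MvPolynomial.C = P := by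
      rw [← hQ]
      ext a
      simp only [Ideal.mem_comap, Q']
      have : e (Polynomial.C (MvPolynomial.C a)) = MvPolynomial.C a := by
        rw [← RingEquiv.eq_symm_apply]
        exact (MvPolynomial.finSuccEquiv_apply R n _ |>.trans (by simp)).symm
      rw [this]
    have := ih (Q'.comap Polynomial.C) hQ'
    have := Polynomial.isRegularLocalRing_localization_atPrime Q'
    exact .localization_atPrime_of_ringEquiv e Q

/-! ### The Jacobian criterion through Frobenius-Witt derivations. -/

/-- A Frobenius-Witt derivation `P → k` that vanishes on `A` factors through the Kähler
differentials. -/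
theorem IsFWDerivation.eq_zero_of_one_tmul_D_eq_zero {p : ℕ} [hp : Fact p.Prime] {A P k : Type*}
    [CommRing A] [CommRing P] [Field k] [Algebra A P] [Algebra P k] [CharP k p] {δ : P → k}
    (hδ : IsFWDerivation p δ) (hA : ∀ a, δ (algebraMap A P a) = 0) {y : P}
    (hy : (1 : k) ⊗ₜ[P] KaehlerDifferential.D A P y = 0) : δ y = 0 := by
  have hpz : δ (p : P) = 0 := by rw [← map_natCast (algebraMap A P), hA]
  -- With scalars acting through Frobenius, `δ` is an ordinary `A`-derivation.
  let N := RestrictAlong (frobenius k p) k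
  let of := RestrictAlong.of (frobenius k p) k
  let _ : Module P N := Module.compHom N (algebraMap P k)
  let _ : Module A N := Module.compHom N (algebraMap A P)
  have : IsScalarTower P k N := ⟨fun a b x => by rw [Algebra.smul_def, mul_smul]; rfl⟩
  have : IsScalarTower A P N := ⟨fun a b x => by rw [Algebra.smul_def, mul_smul]; rfl⟩
  have hmul : ∀ a b, of (δ (a * b)) = a • of (δ b) + b • of (δ a) := by
    intro a b
    have h : ∀ (r : P) (m : k), r • of m = of (r ^ p • m) := by
      intro r m
      rw [Algebra.smul_def, map_pow]
      rfl
    rw [hδ.map_mul, _root_.map_add, h, h, add_comm]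
  let D : Derivation A P N :=
    { toFun := fun a => of (δ a)
      map_add' := fun a b => by rw [hδ.map_add, hpz, smul_zero, sub_zero, _root_.map_add]
      map_smul' := fun a b => by
        rw [Algebra.smul_def, hmul, hA, _root_.map_zero, smul_zero, add_zero, algebraMap_smul,
          RingHom.id_apply]
      map_one_eq_zero' := by
        change of (δ 1) = 0
        rw [hδ.map_one, _root_.map_zero]
      leibniz' := hmul }
  have h := congrArg (D.liftKaehlerDifferential.liftBaseChange k) hy
  rw [LinearMap.liftBaseChange_tmul, one_smul, Derivation.liftKaehlerDifferential_comp_D,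
    _root_.map_zero] at h
  exact h

theorem IsFWDerivation.sub {p : ℕ} {A M : Type*} [CommRing A] [AddCommGroup M] [Module A M]
    {v w : A → M} (hv : IsFWDerivation p v) (hw : IsFWDerivation p w) :
    IsFWDerivation p (fun a => v a - w a) where
  map_add a b := by rw [hv.map_add, hw.map_add, smul_sub]; abel
  map_mul a b := by rw [hv.map_mul, hw.map_mul, smul_sub, smul_sub]; abel

open IsLocalRing in
/-- An element of `𝔪 \ 𝔪²` is detected by a linear form on the cotangent space. -/
theorem IsLocalRing.exists_linearMap_ne_zero {R : Type*} [CommRing R] [IsLocalRing R]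
    (y : maximalIdeal R) (hy : (y : R) ∉ maximalIdeal R ^ 2) :
    ∃ φ : maximalIdeal R →ₗ[R] ResidueField R, φ y ≠ 0 := by
  have hv : (maximalIdeal R).toCotangent y ≠ 0 :=
    fun h => hy (((maximalIdeal R).toCotangent_eq_zero _).mp h)
  obtain ⟨f, hf⟩ := Module.Projective.exists_dual_ne_zero (ResidueField R) hv
  exact ⟨(f.restrictScalars R) ∘ₗ (maximalIdeal R).toCotangent, hf⟩

section Criterion

open IsLocalRing

variable {p : ℕ} [hp : Fact p.Prime] {A P S : Type*} [CommRing A] [CommRing P] [CommRing S]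
  [Algebra A P] [Algebra P S] [Algebra A S] [IsScalarTower A P S]
  [IsRegularLocalRing P] [IsRegularLocalRing S] [CharP (ResidueField S) p]

/-- If every Frobenius-Witt derivation of `A` with values in the residue field of `S` extends
to `S`, then the conormal module of a closed immersion into a regular local ring injects into the
differentials after base change to the residue field. -/
theorem mem_mul_ker_of_one_tmul_D_eq_zero (hsurj : Function.Surjective (algebraMap P S))
    (hext : ∀ w : A → ResidueField S, IsFWDerivation p w →
      ∃ D : S → ResidueField S, IsFWDerivation p D ∧ ∀ a, D (algebraMap A S a) = w a)
    {y : P} (hy : y ∈ RingHom.ker (algebraMap P S))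
    (hd : (1 : ResidueField S) ⊗ₜ[P] KaehlerDifferential.D A P y = 0) :
    y ∈ maximalIdeal P * RingHom.ker (algebraMap P S) := by
  have := IsLocalHom.of_surjective (algebraMap P S) hsurj
  have : IsRegularLocalRing (P ⧸ RingHom.ker (algebraMap P S)) :=
    .of_ringEquiv (RingHom.quotientKerEquivOfSurjective hsurj).symm
  refine IsRegularLocalRing.mem_mul_of_mem_sq hy ?_
  by_contra hy2
  have hym : y ∈ maximalIdeal P := le_maximalIdeal (RingHom.ker_ne_top _) hy
  obtain ⟨φ, hφ⟩ := exists_linearMap_ne_zero ⟨y, hym⟩ hy2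
  have : CharP (ResidueField P) p :=
    (RingHom.charP_iff (algebraMap (ResidueField P) (ResidueField S)) (RingHom.injective _) p).mpr ‹_›
  obtain ⟨w, hw, hwφ⟩ := exists_isFWDerivation_eq_pow (p := p) φ
  let g : ResidueField P →ₗ[P] ResidueField S :=
    (IsScalarTower.toAlgHom P (ResidueField P) (ResidueField S)).toLinearMap
  have hgw : IsFWDerivation p (fun a => g (w a)) := hw.linearMap_comp g
  obtain ⟨D, hD, hDw⟩ := hext _ (hgw.comp_algebraMap (A := A))
  -- The difference vanishes on `A`, so it kills `y`; the extension `D` also kills `y`, because `y`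
  -- maps to zero in `S`.
  have hδ := hgw.sub (hD.comp_algebraMap (A := P))
  have h0 := hδ.eq_zero_of_one_tmul_D_eq_zero (A := A) (fun a => by
    rw [← IsScalarTower.algebraMap_apply, hDw, sub_self]) hd
  rw [(RingHom.mem_ker).mp hy, hD.map_zero, sub_zero, hwφ ⟨y, hym⟩] at h0
  exact hφ (pow_eq_zero_iff hp.out.ne_zero |>.mp
    ((map_eq_zero (algebraMap (ResidueField P) (ResidueField S))).mp h0))

/-- By the Jacobian criterion, injectivity of `k ⊗ I → k ⊗ Ω` suffices. As `P → k` is onto, every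
element of `k ⊗ I` is `1 ⊗ y`, and it vanishes once `y ∈ 𝔪I`. -/
theorem Algebra.FormallySmooth.of_exists_isFWDerivation [Algebra.FormallySmooth A P]
    [Module.Free P Ω[P⁄A]] [Module.Finite P Ω[P⁄A]]
    (hsurj : Function.Surjective (algebraMap P S)) (hfg : (RingHom.ker (algebraMap P S)).FG)
    (hext : ∀ w : A → ResidueField S, IsFWDerivation p w →
      ∃ D : S → ResidueField S, IsFWDerivation p D ∧ ∀ a, D (algebraMap A S a) = w a) :
    Algebra.FormallySmooth A S := by
  rw [Algebra.FormallySmooth.iff_injective_cotangentComplexBaseChange_residueField P hsurj hfg,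
    injective_iff_map_eq_zero]
  intro z hz
  have hsurj' : Function.Surjective (algebraMap P (ResidueField S)) := by
    rw [IsScalarTower.algebraMap_eq P S]
    exact residue_surjective.comp hsurj
  obtain ⟨y, rfl⟩ := TensorProduct.mk_surjective P (RingHom.ker (algebraMap P S)) (ResidueField S)
    hsurj' z
  have hd : (1 : ResidueField S) ⊗ₜ[P] KaehlerDifferential.D A P y.1 = 0 := by
    rw [TensorProduct.mk_apply, KaehlerDifferential.cotangentComplexBaseChange_tmul, one_smul] at hz
    exact hz
  have hy := mem_mul_ker_of_one_tmul_D_eq_zero hsurj hext y.2 hd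
  have := IsLocalHom.of_surjective (algebraMap P S) hsurj
  have hle : maximalIdeal P * RingHom.ker (algebraMap P S)
      ≤ (LinearMap.ker (TensorProduct.mk P (ResidueField S) (RingHom.ker (algebraMap P S)) 1)).map
        (RingHom.ker (algebraMap P S)).subtype := by
    rw [Ideal.mul_le]
    intro r hr s hs
    refine ⟨r • ⟨s, hs⟩, ?_, rfl⟩
    have hr0 : algebraMap P (ResidueField S) r = 0 := by
      rw [IsScalarTower.algebraMap_apply P S]
      exact (residue_eq_zero_iff _).mpr (map_maximalIdeal_le (algebraMap P S)
        (Ideal.mem_map_of_mem _ hr))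
    change (1 : ResidueField S) ⊗ₜ[P] (r • (⟨s, hs⟩ : RingHom.ker (algebraMap P S))) = 0
    rw [← TensorProduct.smul_tmul, Algebra.smul_def, hr0, zero_mul, TensorProduct.zero_tmul]
  obtain ⟨y', hy', h⟩ := hle hy
  rwa [← Subtype.ext h]

end Criterion

/-! ### From local splitness to smoothness at `𝔮`. -/

section Local

variable (p : ℕ) [hp : Fact p.Prime] {A B : Type*} [CommRing A] [CommRing B] [Algebra A B]

/-- Local splitness of `FΩ¹_A ⊗_A B → FΩ¹_B` lets Frobenius-Witt derivations extend. -/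
theorem FWDiff.exists_extension_of_isSplitExact (q : Ideal B) [q.IsPrime] [CharP q.ResidueField p]
    (h : IsSplitExact ((mapBaseChange p A B).baseChange (Localization.AtPrime q))
      ((toPullback p A B).baseChange (Localization.AtPrime q)))
    {w : A → q.ResidueField} (hw : IsFWDerivation p w) :
    ∃ D : Localization.AtPrime q → q.ResidueField, IsFWDerivation p D ∧
      ∀ a, D (algebraMap A (Localization.AtPrime q) a) = w a := by
  obtain ⟨r, hr⟩ := h.exists_retraction
  let l : Localization.AtPrime q ⊗[B] (B ⊗[A] FWDiff p A) →ₗ[Localization.AtPrime q]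
      q.ResidueField := ((lift w hw).liftBaseChange B).liftBaseChange (Localization.AtPrime q)
  -- The local retraction followed by the linear map of `w` yields a derivation of `B` extending
  -- `w`; formal smoothness of `B → B_𝔮` carries it to the localization.
  let g : FWDiff p B →ₗ[B] q.ResidueField :=
    ((l ∘ₗ r).restrictScalars B) ∘ₗ (TensorProduct.mk B (Localization.AtPrime q) (FWDiff p B) 1)
  have hg : IsFWDerivation p (fun b => g (FWDiff.w p B b)) :=
    (isFWDerivation_w p B).linearMap_comp g
  have hgw : ∀ a, g (FWDiff.w p B (algebraMap A B a)) = w a := by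
    intro a
    have h1 := DFunLike.congr_fun hr (1 ⊗ₜ (1 ⊗ₜ FWDiff.w p A a))
    rw [LinearMap.comp_apply, LinearMap.baseChange_tmul, mapBaseChange_tmul_w, one_smul,
      LinearMap.id_apply] at h1
    change l (r (1 ⊗ₜ FWDiff.w p B (algebraMap A B a))) = w a
    rw [h1, LinearMap.liftBaseChange_tmul, one_smul, LinearMap.liftBaseChange_tmul, one_smul,
      lift_w]
  have : Algebra.FormallySmooth B (Localization.AtPrime q) :=
    Algebra.FormallySmooth.of_isLocalization q.primeCompl
  obtain ⟨D, hD, hDw⟩ := hg.exists_extension (B := Localization.AtPrime q) (fun m => by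
    rw [Algebra.smul_def, map_natCast, CharP.cast_eq_zero, zero_mul])
  exact ⟨D, hD, fun a => by rw [IsScalarTower.algebraMap_apply A B, hDw, hgw]⟩

theorem FWDiff.isSmoothAt_of_isSplitExact [Algebra.FinitePresentation A B] (q : Ideal B)
    [q.IsPrime] [CharP q.ResidueField p]
    [IsRegularLocalRing (Localization.AtPrime (q.comap (algebraMap A B)))]
    [IsRegularLocalRing (Localization.AtPrime q)]
    (h : IsSplitExact ((mapBaseChange p A B).baseChange (Localization.AtPrime q))
      ((toPullback p A B).baseChange (Localization.AtPrime q))) :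
    Algebra.IsSmoothAt A q := by
  let S := Localization.AtPrime q
  obtain ⟨n, f₀, hf₀⟩ := Algebra.FiniteType.iff_quotient_mvPolynomial''.mp
    (inferInstance : Algebra.FiniteType A B)
  let Q : Ideal (MvPolynomial (Fin n) A) := q.comap f₀
  let P := Localization.AtPrime Q
  have hreg : IsRegularLocalRing P :=
    MvPolynomial.isRegularLocalRing_localization_atPrime Q (q.comap (algebraMap A B)) (by
      ext a
      rw [Ideal.mem_comap, Ideal.mem_comap, Ideal.mem_comap, ← f₀.commutes]
      rfl)
  let fP : P →ₐ[A] S := IsLocalization.liftAlgHom (M := Q.primeCompl)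
      (f := (IsScalarTower.toAlgHom A B S).comp f₀) fun x ↦ by
    simpa using IsLocalization.map_units (M := q.primeCompl) S ⟨f₀ x.1, x.2⟩
  have hf₁ : Function.Surjective fP := by
    intro x
    obtain ⟨x, ⟨s, hs⟩, rfl⟩ := IsLocalization.exists_mk'_eq q.primeCompl x
    obtain ⟨x, rfl⟩ := hf₀ x
    obtain ⟨s, rfl⟩ := hf₀ s
    refine ⟨IsLocalization.mk' (M := Q.primeCompl) _ x ⟨s, hs⟩, ?_⟩
    simp [fP, IsLocalization.lift_mk', Units.mul_inv_eq_iff_eq_mul, IsUnit.liftRight]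
  algebraize [fP.toRingHom]
  have : IsScalarTower A P S := .of_algebraMap_eq fun a => (fP.commutes a).symm
  -- Localization is formally étale, so `Ω[P⁄A]` is the base change of the free differentials of the
  -- polynomial ring.
  have : Algebra.FormallyEtale (MvPolynomial (Fin n) A) P := .of_isLocalization Q.primeCompl
  have : Algebra.FormallySmooth A P := .comp _ (MvPolynomial (Fin n) A) _
  have : Module.Free P Ω[P⁄A] :=
    .of_equiv (KaehlerDifferential.tensorKaehlerEquivOfFormallyEtale A (MvPolynomial (Fin n) A) P)
  have : Module.Finite P Ω[P⁄A] :=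
    .equiv (KaehlerDifferential.tensorKaehlerEquivOfFormallyEtale A (MvPolynomial (Fin n) A) P)
  exact Algebra.FormallySmooth.of_exists_isFWDerivation (p := p) (P := P) hf₁
    (Ideal.fg_of_isNoetherianRing _) fun w hw => exists_extension_of_isSplitExact p q h hw

end Local

end

theorem mainTheorem8 (p : ℕ) [Fact p.Prime] {A B : Type*} [CommRing A] [CommRing B]
    [Algebra (ZLoc p) A] [Algebra (ZLoc p) B] [Algebra A B] [Algebra.FinitePresentation A B] :
    (Algebra.Smooth A B →
      IsSplitExact (FWDiff.mapBaseChange p A B) (FWDiff.toPullback p A B) ∧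
      Function.Bijective (FWDiff.cokerToPullback p A B) ∧
      Module.Projective (RingModP p B) (FWDiff.Coker p A B) ∧
      Module.Finite (RingModP p B) (FWDiff.Coker p A B) ∧
      Module.Projective (RingModP p B) (FrobPullback p B (KaehlerModP p A B)) ∧
      Module.Finite (RingModP p B) (FrobPullback p B (KaehlerModP p A B))) ∧
    (∀ (q : Ideal B) [q.IsPrime] [CharP q.ResidueField p]
      [IsRegularLocalRing (Localization.AtPrime (q.comap (algebraMap A B)))]
      [IsRegularLocalRing (Localization.AtPrime q)],
      IsSplitExact
        ((FWDiff.mapBaseChange p A B).baseChange (Localization.AtPrime q))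
        ((FWDiff.toPullback p A B).baseChange (Localization.AtPrime q)) →
      ∃ g : B, g ∉ q ∧ Algebra.Smooth A (Localization.Away g)) := by
  refine ⟨fun _ => ?_, fun q _ _ _ _ h => ?_⟩
  · have h1 := FWDiff.projective_pullback p A B
    have h2 := FWDiff.finite_pullback p A B
    exact ⟨FWDiff.isSplitExact_of_formallySmooth p A B, FWDiff.cokerToPullback_bijective p A B,
      .of_equiv (FWDiff.cokerEquiv p A B).symm, .equiv (FWDiff.cokerEquiv p A B).symm, h1, h2⟩
  · have := FWDiff.isSmoothAt_of_isSplitExact p q h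
    exact Algebra.IsSmoothAt.exists_notMem_smooth (R := A) q
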